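/- Let $X\subset P^3$ be a nonsingular real cubic surface, defined by a homogeneous polynomial $f\in\mathbb R[X_0,\dots,X_3]$ of degree $3$ whose partial derivatives have no common zero among the complex points of $X$. A real line on $X$ is a point $\ell$ of the Grassmannian $G_2(\mathbb R^4)$, i.e. a two-dimensional linear subspace of $\mathbb R^4$, on which $f$ vanishes; equivalently, a zero of the section $s_f\colon p\mapsto f|_p$ of $\mathrm{Sym}^3(\tau^*)$, where $\tau$ is the tautological bundle over $G_2(\mathbb R^4)$. *Segre's species.* Given a real line $\ell\subset X$, choose linear coordinates $x,y,u,v$ on $\mathbb R^4$ in which $\ell=\{x=y=0\}$; then $$f=u^2L_{11}+2uvL_{12}+v^2L_{22}+uQ_1+vQ_2+C,$$ where $L_{ij}=l_{ij}x+m_{ij}y$, $Q_i$ and $C$ are forms in $x,y$ of degrees one, two and three. The line is hyperbolic (resp. elliptic) if in some such coordinates the quadratic form $L_{12}^2-L_{11}L_{22}$ is indefinite (resp. positive or negative definite). *Index.* The polar correspondence sends a point $[w]$ of the complex quadric $Q=\{w_0^2+\dots+w_3^2=0\}\subset P^3(\mathbb C)$ to the real plane $\{\mathrm{Re}(zw):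 z\in\mathbb C\}$, and makes $Q$ a double covering of $G_2(\mathbb R^4)$ with the complex conjugation as deck transformation. If $L$ denotes the dual of the tautological complex line bundle of $Q$, the pull-back of $\mathrm{Sym}^3(\tau^*)$ to $Q$ is identified with $L^3\oplus L^2\bar L$ by taking real parts: $(\alpha,\beta)$ goes to the cubic form $\mathrm{Re}(\alpha z^3+\beta z^2\bar z)$. The complex orientations of $Q$ and of $L^3\oplus L^2\bar L$ are invariant under conjugation and orient the total space of $\mathrm{Sym}^3(\tau^*)$. The index $I_\ell$ of an isolated zero $\ell$ of $s_f$ is its local Euler number (local degree) with respect to this orientation. **Proposition.** There are finitely many real lines on $X$. Each of them is either hyperbolic or elliptic, but not both, and has a well-defined index; the hyperbolic lines are exactly those of index $+1$ and the elliptic lines are exactly those of index $-1$. Hence the numbers $h$ and $e$ of hyperbolic and elliptic real lines and the numbers $N^{+}$ and $N^{-}$ of real lines of index $+1$ and $-1$ satisfy $$h=N^{+},\qquad e=N^{-}.$$ Moreover, for any coordinates $x,y,u,v$ as above, let $(x_1,x_2,y_1,y_2)$ be the local coordinates on $G_2(\mathbb R^4)$ at $\ell$ that stand for the line $(u,v)\mapsto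 u(x_1,y_1,1,0)+v(x_2,y_2,0,1)$, and trivialize $\mathrm{Sym}^3(\tau^*)$ by the frame $u^3,u^2v,uv^2,v^3$. Then the Jacobi matrix of $s_f$ at $\ell$ is $$J=\begin{pmatrix} l_{11}&0&m_{11}&0\\ 2l_{12}&l_{11}&2m_{12}&m_{11}\\ l_{22}&2l_{12}&m_{22}&2m_{12}\\ 0&l_{22}&0&m_{22}\end{pmatrix},$$ its determinant is opposite to the discriminant of the binary quadratic form $L_{12}^2-L_{11}L_{22}=Ax^2+Bxy+Cy^2$, that is, $\det J=-(4AC-B^2)$, and the index of $\ell$ is the sign of $\det J$. -/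

import Mathlib

/-! ### Cubic surfaces and the real lines on them -/

/-- The surface `f = 0` in the projective space `P³` is nonsingular: the partial derivatives of `f`
have no common zero among the complex points of the surface. -/
def IsNonsingularSurface (f : MvPolynomial (Fin 4) ℝ) : Prop :=
  ∀ z : Fin 4 → ℂ, z ≠ 0 → MvPolynomial.aeval z f = 0 →
    ∃ i : Fin 4, MvPolynomial.aeval z (MvPolynomial.pderiv i f) ≠ 0

/-- The real lines lying on the surface `f = 0`. A line of the real projective space `P³` is a point
of the Grassmannian `G₂(ℝ⁴)`, that is, a two-dimensional linear subspace of `ℝ⁴`. -/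
def realLines (f : MvPolynomial (Fin 4) ℝ) : Set (Submodule ℝ (Fin 4 → ℝ)) :=
  {ℓ | Module.finrank ℝ ℓ = 2 ∧ ∀ v ∈ ℓ, MvPolynomial.eval v f = 0}

/-! ### Segre's two species of real lines -/

/-- Linear coordinates `x, y, u, v` on `ℝ⁴` (those of the basis `e`) in which `ℓ` is given by
`x = y = 0`, with the resulting shape
`f = u² L₁₁ + 2 u v L₁₂ + v² L₂₂ + u Q₁ + v Q₂ + C`,
where `Lᵢⱼ`, `Qᵢ`, `C` are forms in `x, y` of degrees one, two and three. -/
structure SegreCoordinates (f : MvPolynomial (Fin 4) ℝ) (ℓ : Submodule ℝ (Fin 4 → ℝ)) where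
  e : Module.Basis (Fin 4) ℝ (Fin 4 → ℝ)
  line_eq : ℓ = Submodule.span ℝ {e 2, e 3}
  L₁₁ : (Fin 2 → ℝ) →ₗ[ℝ] ℝ
  L₁₂ : (Fin 2 → ℝ) →ₗ[ℝ] ℝ
  L₂₂ : (Fin 2 → ℝ) →ₗ[ℝ] ℝ
  Q₁ : QuadraticForm ℝ (Fin 2 → ℝ)
  Q₂ : QuadraticForm ℝ (Fin 2 → ℝ)
  C : MvPolynomial (Fin 2) ℝ
  C_homogeneous : C.IsHomogeneous 3
  shape : ∀ x y u v : ℝ,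
    MvPolynomial.eval (x • e 0 + y • e 1 + u • e 2 + v • e 3) f =
      u ^ 2 * L₁₁ ![x, y] + 2 * u * v * L₁₂ ![x, y] + v ^ 2 * L₂₂ ![x, y]
        + u * Q₁ ![x, y] + v * Q₂ ![x, y] + MvPolynomial.eval ![x, y] C

namespace SegreCoordinates

variable {f : MvPolynomial (Fin 4) ℝ} {ℓ : Submodule ℝ (Fin 4 → ℝ)}

/-- The binary quadratic form `L₁₂² - L₁₁ L₂₂`. -/
def form (S : SegreCoordinates f ℓ) : QuadraticForm ℝ (Fin 2 → ℝ) :=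
  QuadraticMap.linMulLin S.L₁₂ S.L₁₂ - QuadraticMap.linMulLin S.L₁₁ S.L₂₂

/-- The matrix built from the coefficients of `Lᵢⱼ = lᵢⱼ x + mᵢⱼ y`. -/
def jacobian (S : SegreCoordinates f ℓ) : Matrix (Fin 4) (Fin 4) ℝ :=
  !![S.L₁₁ ![1, 0], 0, S.L₁₁ ![0, 1], 0;
     2 * S.L₁₂ ![1, 0], S.L₁₁ ![1, 0], 2 * S.L₁₂ ![0, 1], S.L₁₁ ![0, 1];
     S.L₂₂ ![1, 0], 2 * S.L₁₂ ![1, 0], S.L₂₂ ![0, 1], 2 * S.L₁₂ ![0, 1];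
     0, S.L₂₂ ![1, 0], 0, S.L₂₂ ![0, 1]]

/-- The map `c` expresses the section `ℓ' ↦ f|ℓ'` of `Sym³(τ*)` in the local coordinates
`a = (x₁, x₂, y₁, y₂)` of `G₂(ℝ⁴)`, which stand for the line
`(u, v) ↦ u (x₁, y₁, 1, 0) + v (x₂, y₂, 0, 1)`, and the frame `u³, u²v, uv², v³`. -/
def IsSectionInCoordinates (S : SegreCoordinates f ℓ) (c : (Fin 4 → ℝ) → (Fin 4 → ℝ)) : Prop :=
  ∀ (a : Fin 4 → ℝ) (u v : ℝ),
    MvPolynomial.eval (u • (a 0 • S.e 0 + a 2 • S.e 1 + S.e 2)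
        + v • (a 1 • S.e 0 + a 3 • S.e 1 + S.e 3)) f =
      c a 0 * u ^ 3 + c a 1 * (u ^ 2 * v) + c a 2 * (u * v ^ 2) + c a 3 * v ^ 3

end SegreCoordinates

/-- The form takes both positive and negative values. -/
def IsIndefiniteForm (q : QuadraticForm ℝ (Fin 2 → ℝ)) : Prop :=
  (∃ a, 0 < q a) ∧ ∃ b, q b < 0

/-- The form is positive definite or negative definite. -/
def IsDefiniteForm (q : QuadraticForm ℝ (Fin 2 → ℝ)) : Prop :=
  q.PosDef ∨ (-q).PosDef

/-- The line `ℓ` on the surface `f = 0` is hyperbolic in the sense of Segre. -/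
def IsHyperbolicLine (f : MvPolynomial (Fin 4) ℝ) (ℓ : Submodule ℝ (Fin 4 → ℝ)) : Prop :=
  ∃ S : SegreCoordinates f ℓ, IsIndefiniteForm S.form

/-- The line `ℓ` on the surface `f = 0` is elliptic in the sense of Segre. -/
def IsEllipticLine (f : MvPolynomial (Fin 4) ℝ) (ℓ : Submodule ℝ (Fin 4 → ℝ)) : Prop :=
  ∃ S : SegreCoordinates f ℓ, IsDefiniteForm S.form

/-! ### The local Euler number of the section `ℓ ↦ f|ℓ` of `Sym³(τ*)` -/

/-- The local degree of `g` at its isolated zero `x`: the number of preimages near `x`, counted with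
the signs of the Jacobian, of any regular value close enough to `0`. -/
def HasLocalDegree {E : Type*} [NormedAddCommGroup E] [NormedSpace ℝ E]
    (g : E → E) (x : E) (d : ℤ) : Prop :=
  ∃ r : ℝ, 0 < r ∧
    (∀ y ∈ Metric.closedBall x r, ContDiffAt ℝ 1 g y) ∧
    (∀ y ∈ Metric.closedBall x r, g y = 0 ↔ y = x) ∧
    ∃ ε : ℝ, 0 < ε ∧ ∀ c : E, ‖c‖ < ε →
      (∀ y ∈ Metric.closedBall x r, g y = c → (fderiv ℝ g y).det ≠ 0) →
      {y ∈ Metric.closedBall x r | g y = c}.Finite ∧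
      ∑ᶠ y ∈ {y ∈ Metric.closedBall x r | g y = c},
        ((SignType.sign (fderiv ℝ g y).det : SignType) : ℤ) = d

/-- The real parts of the vectors of the complex line `ℂ w`, parametrized by `z ↦ Re (z w)`. -/
noncomputable def polarParam (w : Fin 4 → ℂ) : ℂ →ₗ[ℝ] (Fin 4 → ℝ) where
  toFun z := fun i => (z * w i).re
  map_add' z z' := by
    funext i
    simp [add_mul]
  map_smul' t z := by
    funext i
    simp [mul_assoc]

/-- The polar correspondence: a point `[w]` of the quadric `w₀² + w₁² + w₂² + w₃² = 0` of `P³(ℂ)`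
goes to the real plane to which the complex line `ℂ w` projects by taking real parts. -/
noncomputable def polarPlane (w : Fin 4 → ℂ) : Submodule ℝ (Fin 4 → ℝ) :=
  LinearMap.range (polarParam w)

/-- `ζ ↦ [w ζ]` is, near `0 ∈ ℂ²`, a holomorphic local parametrization of the complex surface
`w₀² + w₁² + w₂² + w₃² = 0` in `P³(ℂ)`, and `[w 0]` corresponds to the plane `ℓ`. (The linear
independence says that the differential of `ζ ↦ [w ζ]` at `0` is injective.) -/
structure IsPolarChart (ℓ : Submodule ℝ (Fin 4 → ℝ)) (w : ℂ × ℂ → (Fin 4 → ℂ)) : Prop where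
  holomorphic : AnalyticAt ℂ w 0
  mem_quadric : ∀ᶠ ζ in nhds (0 : ℂ × ℂ), ∑ i, w ζ i ^ 2 = 0
  regular : LinearIndependent ℂ ![w 0, fderiv ℂ w 0 (1, 0), fderiv ℂ w 0 (0, 1)]
  center : polarPlane (w 0) = ℓ

/-- `g` expresses near `0` the section `p ↦ f|p` of `Sym³` of the dual tautological bundle over the
quadric, the plane `p` being that of the point `[w ζ]`: the fibre is identified with that of the
complex bundle `L³ ⊕ L² L̄`, where `L` is the dual of the tautological complex line bundle with the
frame `z` dual to `w`, by sending `(α, β)` to the real part of `α z³ + β z² z̄`. -/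
def IsSectionInChart (f : MvPolynomial (Fin 4) ℝ) (w : ℂ × ℂ → (Fin 4 → ℂ))
    (g : ℂ × ℂ → ℂ × ℂ) : Prop :=
  ∀ᶠ ζ in nhds (0 : ℂ × ℂ), ∀ z : ℂ,
    MvPolynomial.eval (polarParam (w ζ) z) f =
      ((g ζ).1 * z ^ 3 + (g ζ).2 * (z ^ 2 * (starRingEnd ℂ) z)).re

/-- The index (local Euler number) at `ℓ` of the section `p ↦ f|p` of `Sym³(τ*)` over `G₂(ℝ⁴)` is
`d`. The total space is oriented, through the polar correspondence, by the complex orientations of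
the quadric and of `L³ ⊕ L² L̄`; both are preserved by the complex conjugation, which interchanges the
two points of the quadric over `ℓ`. The index is thus the local degree of the expression of the
section in a complex chart and a complex trivialization. -/
def HasIndex (f : MvPolynomial (Fin 4) ℝ) (ℓ : Submodule ℝ (Fin 4 → ℝ)) (d : ℤ) : Prop :=
  ∃ (w : ℂ × ℂ → (Fin 4 → ℂ)) (g : ℂ × ℂ → ℂ × ℂ),
    IsPolarChart ℓ w ∧ IsSectionInChart f w g ∧ HasLocalDegree g 0 d

/-! ### The numbers of lines -/

/-- `h`, the number of hyperbolic real lines. -/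
noncomputable def hyperbolicCount (f : MvPolynomial (Fin 4) ℝ) : ℕ :=
  {ℓ ∈ realLines f | IsHyperbolicLine f ℓ}.ncard

/-- `e`, the number of elliptic real lines. -/
noncomputable def ellipticCount (f : MvPolynomial (Fin 4) ℝ) : ℕ :=
  {ℓ ∈ realLines f | IsEllipticLine f ℓ}.ncard

/-- `N⁺` (for `d = 1`) and `N⁻` (for `d = -1`): the number of real lines of index `d`. -/
noncomputable def indexCount (f : MvPolynomial (Fin 4) ℝ) (d : ℤ) : ℕ :=
  {ℓ ∈ realLines f | HasIndex f ℓ d}.ncard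

/-! Let `p`, `q` span a real line, and let `a`, `b` be transversal vectors. On the line the
derivatives of `f` along `a` and `b` are binary quadratic forms `l = l₁₁u² + 2l₁₂uv + l₂₂v²` and `m
= m₁₁u² + 2m₁₂uv + m₂₂v²`. Displacing the line changes `f|ℓ` to first order by `(u x₁ + v x₂) l + (u
y₁ + v y₂) m`. Hence the Jacobi matrix is the Sylvester matrix of `l` and `m`, and its determinant
is their resultant. As a polynomial in the coefficients this resultant is also the discriminant `B²
- 4AC` of `L₁₂² - L₁₁L₂₂` (`det_binaryQuadratic`, `SegreCoordinates.det_jacobian`).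

If the resultant were zero, `l` and `m` would have a common complex zero. At that point of the
complexified line all partial derivatives of `f` would vanish, against nonsingularity
(`det_lineJacobian_ne_zero`). So every real line is a nondegenerate zero, and the sign of `det J`
decides between the two species.

For the index, the differential of the section in a complex chart of the quadric is `J` composed
with maps of positive determinant: a complex linear isomorphism, the comparison of the real frames
with the complex ones (determinant `1/16`), and a change of basis of `ℓ`, which enters by a fourth
power (`exists_hasFDerivAt_section`). Thus every chart gives the sign of `det J`, and an explicit
rational chart shows that an index exists.

Finiteness: nondegenerate zeros are isolated (`SegreCoordinates.eventually_span_eq`), and the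
orthonormal frames of real lines form a compact set. -/

/-! ### The polar trilinear form of a cubic form -/

open MvPolynomial in
/-- The symmetric trilinear form with coefficients in the third partial derivatives of `f`, whose
restriction to the diagonal is `f` when `f` is a cubic form. -/
noncomputable def cubicPolar {K : Type*} [CommRing K] [Algebra ℝ K] (f : MvPolynomial (Fin 4) ℝ)
    (a b c : Fin 4 → K) : K :=
  ∑ i, ∑ j, ∑ k, algebraMap ℝ K (coeff 0 (pderiv i (pderiv j (pderiv k f))) / 6) *
    (a i * b j * c k)

namespace cubicPolar

variable {K : Type*} [CommRing K] [Algebra ℝ K] (f : MvPolynomial (Fin 4) ℝ)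

lemma pderiv_comm (i j : Fin 4) (g : MvPolynomial (Fin 4) ℝ) :
    MvPolynomial.pderiv i (MvPolynomial.pderiv j g)
      = MvPolynomial.pderiv j (MvPolynomial.pderiv i g) := by
  induction g using MvPolynomial.induction_on with
  | C a => simp
  | add p q hp hq => simp [hp, hq]
  | mul_X p n hp =>
    simp only [Derivation.leibniz, map_add, smul_eq_mul, hp, MvPolynomial.pderiv_X, Pi.single_apply]
    split_ifs <;> simp <;> ring

lemma swap₁₂ (a b c : Fin 4 → K) : cubicPolar f a b c = cubicPolar f b a c := by
  unfold cubicPolar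
  rw [Finset.sum_comm]
  refine Finset.sum_congr rfl fun i _ => Finset.sum_congr rfl fun j _ =>
    Finset.sum_congr rfl fun k _ => ?_
  rw [pderiv_comm i j, mul_comm (a j)]

lemma swap₂₃ (a b c : Fin 4 → K) : cubicPolar f a b c = cubicPolar f a c b := by
  unfold cubicPolar
  refine Finset.sum_congr rfl fun i _ => ?_
  rw [Finset.sum_comm]
  refine Finset.sum_congr rfl fun j _ => Finset.sum_congr rfl fun k _ => ?_
  rw [pderiv_comm k j, mul_right_comm]

lemma add₃ (a b c c' : Fin 4 → K) :
    cubicPolar f a b (c + c') = cubicPolar f a b c + cubicPolar f a b c' := by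
  simp only [cubicPolar, ← Finset.sum_add_distrib, Pi.add_apply, mul_add]

lemma smul₃ (r : K) (a b c : Fin 4 → K) :
    cubicPolar f a b (r • c) = r * cubicPolar f a b c := by
  simp only [cubicPolar, Finset.mul_sum, Pi.smul_apply, smul_eq_mul]
  refine Finset.sum_congr rfl fun i _ => Finset.sum_congr rfl fun j _ =>
    Finset.sum_congr rfl fun k _ => by ring

lemma add₂ (a b b' c : Fin 4 → K) :
    cubicPolar f a (b + b') c = cubicPolar f a b c + cubicPolar f a b' c := by
  simp only [swap₂₃ f a _ c, add₃]

lemma smul₂ (r : K) (a b c : Fin 4 → K) :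
    cubicPolar f a (r • b) c = r * cubicPolar f a b c := by
  simp only [swap₂₃ f a _ c, smul₃]

lemma add₁ (a a' b c : Fin 4 → K) :
    cubicPolar f (a + a') b c = cubicPolar f a b c + cubicPolar f a' b c := by
  simp only [swap₁₂ f _ b c, add₂]

lemma smul₁ (r : K) (a b c : Fin 4 → K) :
    cubicPolar f (r • a) b c = r * cubicPolar f a b c := by
  simp only [swap₁₂ f _ b c, smul₂]

lemma rotate (a b c : Fin 4 → K) : cubicPolar f a b c = cubicPolar f b c a := by
  rw [swap₁₂, swap₂₃]

/-- The value of `cubicPolar` at real vectors viewed as vectors over `K`. -/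
lemma algebraMap_comp (a b c : Fin 4 → ℝ) :
    cubicPolar f (fun i => algebraMap ℝ K (a i)) (fun i => algebraMap ℝ K (b i))
      (fun i => algebraMap ℝ K (c i)) = algebraMap ℝ K (cubicPolar f a b c) := by
  simp [cubicPolar, map_sum, map_mul]

variable {f}

/-- Third partial derivatives of a cubic are constants. Euler's identity in degree 1 and then in
degree 2 gives the factor `1 · 2`. -/
lemma sum_C_mul_X (hf : f.IsHomogeneous 3) (i : Fin 4) :
    ∑ j, ∑ k, MvPolynomial.X j * (MvPolynomial.X k * MvPolynomial.C (MvPolynomial.coeff 0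
      (MvPolynomial.pderiv k (MvPolynomial.pderiv j (MvPolynomial.pderiv i f)))))
      = 2 * MvPolynomial.pderiv i f := by
  have h1 : (MvPolynomial.pderiv i f).IsHomogeneous 2 := hf.pderiv
  have h2 (j) : (MvPolynomial.pderiv j (MvPolynomial.pderiv i f)).IsHomogeneous 1 := h1.pderiv
  have h3 (j k) : (MvPolynomial.pderiv k (MvPolynomial.pderiv j
      (MvPolynomial.pderiv i f))).IsHomogeneous 0 := (h2 j).pderiv
  have h4 (j k) : MvPolynomial.C (MvPolynomial.coeff 0 (MvPolynomial.pderiv k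
      (MvPolynomial.pderiv j (MvPolynomial.pderiv i f))))
        = MvPolynomial.pderiv k (MvPolynomial.pderiv j (MvPolynomial.pderiv i f)) :=
    (MvPolynomial.totalDegree_eq_zero_iff_eq_C.1
      ((MvPolynomial.totalDegree_zero_iff_isHomogeneous _).2 (h3 j k))).symm
  simp only [h4, ← Finset.mul_sum, (h2 _).sum_X_mul_pderiv, one_smul, h1.sum_X_mul_pderiv]
  simp

/-- The partial derivatives of a cubic form in terms of its polar form. -/
lemma aeval_pderiv (hf : f.IsHomogeneous 3) (z : Fin 4 → K) (i : Fin 4) :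
    MvPolynomial.aeval z (MvPolynomial.pderiv i f) = 3 * cubicPolar f z z (Pi.single i 1) := by
  have h := congrArg (MvPolynomial.aeval z) (sum_C_mul_X hf i)
  simp only [map_sum, map_mul, MvPolynomial.aeval_X, MvPolynomial.aeval_C, map_ofNat] at h
  have h2 : (algebraMap ℝ K (1 / 2)) * 2 = 1 := by
    rw [← map_ofNat (algebraMap ℝ K) 2, ← map_mul]; norm_num
  have h5 : cubicPolar f z z (Pi.single i 1) = ∑ j, ∑ k, algebraMap ℝ K (MvPolynomial.coeff 0
      (MvPolynomial.pderiv i (MvPolynomial.pderiv j (MvPolynomial.pderiv k f))) / 6) *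
        (z j * z k) := by
    rw [rotate, rotate]
    unfold cubicPolar
    rw [Finset.sum_eq_single i (by intro b _ hb; simp [hb]) (by simp)]
    simp
  calc _ = algebraMap ℝ K (1 / 2) * (2 * MvPolynomial.aeval z (MvPolynomial.pderiv i f)) := by
        rw [← mul_assoc, h2, one_mul]
    _ = _ := by
        have h6 : algebraMap ℝ K (1 / 2) = 3 * algebraMap ℝ K (1 / 6) := by
          rw [← map_ofNat (algebraMap ℝ K) 3, ← map_mul]; norm_num
        have h7 (r : ℝ) : algebraMap ℝ K (r / 6) = algebraMap ℝ K r * algebraMap ℝ K (1 / 6) := by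
          rw [← map_mul]; ring_nf
        rw [← h, h5, h6]
        simp only [Finset.mul_sum]
        refine Finset.sum_congr rfl fun j _ => Finset.sum_congr rfl fun k _ => ?_
        rw [pderiv_comm i j, pderiv_comm i k, pderiv_comm j k, h7 (MvPolynomial.coeff 0 _)]
        ring

/-- A cubic form is the restriction of its polar form to the diagonal. -/
lemma aeval_eq (hf : f.IsHomogeneous 3) (z : Fin 4 → K) :
    MvPolynomial.aeval z f = cubicPolar f z z z := by
  have h := congrArg (MvPolynomial.aeval z) hf.sum_X_mul_pderiv
  simp only [map_sum, map_mul, MvPolynomial.aeval_X, aeval_pderiv hf, nsmul_eq_mul, map_natCast] at h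
  have h2 : (algebraMap ℝ K (1 / 3)) * 3 = 1 := by
    rw [← map_ofNat (algebraMap ℝ K) 3, ← map_mul]; norm_num
  have hz : z = ∑ i, z i • (Pi.single i 1 : Fin 4 → K) := by
    ext j; simp [Pi.single_apply]
  have h3 : cubicPolar f z z z = ∑ i, z i * cubicPolar f z z (Pi.single i 1) := by
    conv_lhs => enter [4]; rw [hz]
    simp only [Fin.sum_univ_four, add₃, smul₃]
  have h4 : ∑ i, z i * (3 * cubicPolar f z z (Pi.single i 1)) = 3 * cubicPolar f z z z := by
    rw [h3, Finset.mul_sum]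
    exact Finset.sum_congr rfl fun i _ => by ring
  calc _ = algebraMap ℝ K (1 / 3) * (3 * MvPolynomial.aeval z f) := by
        rw [← mul_assoc, h2, one_mul]
    _ = algebraMap ℝ K (1 / 3) * (3 * cubicPolar f z z z) := by
        rw [← h4, h]; simp
    _ = _ := by rw [← mul_assoc, h2, one_mul]

lemma eval_eq (hf : f.IsHomogeneous 3) (z : Fin 4 → ℝ) :
    MvPolynomial.eval z f = cubicPolar f z z z := by
  rw [← aeval_eq hf, MvPolynomial.aeval_eq_eval]

end cubicPolar

/-! ### Restriction of the cubic to a line, and its derivative -/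

/-- The coefficients of the binary cubic form `f (u p + v q)`. -/
noncomputable def lineCubic (f : MvPolynomial (Fin 4) ℝ) (p q : Fin 4 → ℝ) : Fin 4 → ℝ :=
  ![cubicPolar f p p p, 3 * cubicPolar f p p q, 3 * cubicPolar f q q p, cubicPolar f q q q]

open cubicPolar in
lemma eval_smul_add_smul {f : MvPolynomial (Fin 4) ℝ} (hf : f.IsHomogeneous 3)
    (p q : Fin 4 → ℝ) (u v : ℝ) :
    MvPolynomial.eval (u • p + v • q) f = lineCubic f p q 0 * u ^ 3 +
      lineCubic f p q 1 * (u ^ 2 * v) + lineCubic f p q 2 * (u * v ^ 2) +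
      lineCubic f p q 3 * v ^ 3 := by
  rw [eval_eq hf]
  simp only [lineCubic, add₁, add₂, add₃, smul₁, smul₂, smul₃, Matrix.cons_val]
  rw [swap₁₂ f q p p, swap₂₃ f p q p, swap₂₃ f q p q, swap₁₂ f p q q, swap₂₃ f q p q]
  ring

/-- A binary cubic form determines its coefficients. -/
lemma binaryCubic_coeff_ext {c d : Fin 4 → ℝ}
    (h : ∀ u v : ℝ, c 0 * u ^ 3 + c 1 * (u ^ 2 * v) + c 2 * (u * v ^ 2) + c 3 * v ^ 3 =
      d 0 * u ^ 3 + d 1 * (u ^ 2 * v) + d 2 * (u * v ^ 2) + d 3 * v ^ 3) : c = d := by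
  have h0 := h 1 0
  have h1 := h 0 1
  have h2 := h 1 1
  have h3 := h 1 (-1)
  norm_num at h0 h1 h2 h3
  ext i
  fin_cases i <;> simp <;> linarith

lemma lineCubic_eq_zero {f : MvPolynomial (Fin 4) ℝ} (hf : f.IsHomogeneous 3) {p q : Fin 4 → ℝ}
    (h : ∀ u v : ℝ, MvPolynomial.eval (u • p + v • q) f = 0) : lineCubic f p q = 0 :=
  binaryCubic_coeff_ext fun u v => by rw [← eval_smul_add_smul hf, h]; simp

/-- The derivative of `lineCubic` at `(p, q)` in the direction `(p', q')`. -/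
noncomputable def lineCubicDeriv (f : MvPolynomial (Fin 4) ℝ) (p q p' q' : Fin 4 → ℝ) :
    Fin 4 → ℝ :=
  ![3 * cubicPolar f p p p', 6 * cubicPolar f p q p' + 3 * cubicPolar f p p q',
    3 * cubicPolar f q q p' + 6 * cubicPolar f p q q', 3 * cubicPolar f q q q']

section Derivative

variable {F : Type*} [NormedAddCommGroup F] [NormedSpace ℝ F]

open cubicPolar in
/-- The product rule for the polar form. -/
lemma HasFDerivAt.cubicPolar (f : MvPolynomial (Fin 4) ℝ) {a b c : F → Fin 4 → ℝ}
    {a' b' c' : F →L[ℝ] Fin 4 → ℝ} {x : F} (ha : HasFDerivAt a a' x) (hb : HasFDerivAt b b' x)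
    (hc : HasFDerivAt c c' x) :
    ∃ D : F →L[ℝ] ℝ, HasFDerivAt (fun y => cubicPolar f (a y) (b y) (c y)) D x ∧
      ∀ v, D v = cubicPolar f (a' v) (b x) (c x) + cubicPolar f (a x) (b' v) (c x) +
        cubicPolar f (a x) (b x) (c' v) := by
  rw [hasFDerivAt_pi'] at ha hb hc
  refine ⟨_, HasFDerivAt.fun_sum fun i _ => HasFDerivAt.fun_sum fun j _ =>
    HasFDerivAt.fun_sum fun k _ => (((ha i).mul (hb j)).mul (hc k)).const_mul _, fun v => ?_⟩
  simp only [_root_.cubicPolar, ← Finset.sum_add_distrib, sum_apply]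
  refine Finset.sum_congr rfl fun i _ => Finset.sum_congr rfl fun j _ =>
    Finset.sum_congr rfl fun k _ => ?_
  simp
  ring

open cubicPolar in
lemma HasFDerivAt.lineCubic (f : MvPolynomial (Fin 4) ℝ) {p q : F → Fin 4 → ℝ}
    {p' q' : F →L[ℝ] Fin 4 → ℝ} {x : F} (hp : HasFDerivAt p p' x) (hq : HasFDerivAt q q' x) :
    ∃ D : F →L[ℝ] Fin 4 → ℝ, HasFDerivAt (fun y => lineCubic f (p y) (q y)) D x ∧
      ∀ v, D v = lineCubicDeriv f (p x) (q x) (p' v) (q' v) := by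
  obtain ⟨D0, h0, e0⟩ := HasFDerivAt.cubicPolar f hp hp hp
  obtain ⟨D1, h1, e1⟩ := HasFDerivAt.cubicPolar f hp hp hq
  obtain ⟨D2, h2, e2⟩ := HasFDerivAt.cubicPolar f hq hq hp
  obtain ⟨D3, h3, e3⟩ := HasFDerivAt.cubicPolar f hq hq hq
  refine ⟨ContinuousLinearMap.pi ![D0, (3 : ℝ) • D1, (3 : ℝ) • D2, D3], hasFDerivAt_pi'.2 ?_, ?_⟩
  · intro i
    fin_cases i
    · exact h0
    · exact h1.const_mul 3
    · exact h2.const_mul 3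
    · exact h3
  · intro v
    ext i
    fin_cases i
    · simp [lineCubicDeriv, e0, rotate f (p' v), swap₂₃ f (p x) (p' v)]
      ring
    · simp [lineCubicDeriv, e1, rotate f (p' v), swap₂₃ f (p x) (p' v)]
      ring
    · simp [lineCubicDeriv, e2, rotate f (q' v), swap₂₃ f (q x) (q' v), swap₁₂ f (q x) (p x)]
      ring
    · simp [lineCubicDeriv, e3, rotate f (q' v), swap₂₃ f (q x) (q' v)]
      ring

lemma ContDiff.lineCubic (f : MvPolynomial (Fin 4) ℝ) {p q : F → Fin 4 → ℝ} {n : WithTop ℕ∞}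
    (hp : ContDiff ℝ n p) (hq : ContDiff ℝ n q) :
    ContDiff ℝ n fun y => lineCubic f (p y) (q y) := by
  rw [contDiff_pi] at hp hq ⊢
  intro i
  fin_cases i <;> simp [_root_.lineCubic, cubicPolar] <;> fun_prop

end Derivative

-- Taylor expansion about the line: the terms of degree 1, 2, 3 in `w` correspond to `Lᵢⱼ`, `Qᵢ`,
-- `C` of Segre's normal shape.
open cubicPolar in
lemma eval_add_smul_add_smul {f : MvPolynomial (Fin 4) ℝ} (hf : f.IsHomogeneous 3)
    (w p q : Fin 4 → ℝ) (u v : ℝ) :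
    MvPolynomial.eval (w + u • p + v • q) f = cubicPolar f w w w +
      3 * u * cubicPolar f w w p + 3 * v * cubicPolar f w w q + 3 * u ^ 2 * cubicPolar f p p w +
      6 * u * v * cubicPolar f p q w + 3 * v ^ 2 * cubicPolar f q q w +
      MvPolynomial.eval (u • p + v • q) f := by
  rw [eval_smul_add_smul hf, eval_eq hf]
  simp only [lineCubic, add₁, add₂, add₃, smul₁, smul₂, smul₃, Matrix.cons_val]
  rw [swap₁₂ f p w w, swap₂₃ f w p w, swap₁₂ f q w w, swap₂₃ f w q w, ← rotate f w p p,
    swap₂₃ f p w p, ← rotate f w p p, ← rotate f w q q, swap₂₃ f q w q, ← rotate f w q q,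
    swap₂₃ f q w p, swap₂₃ f p w q, swap₁₂ f q p w, ← rotate f w p q, swap₂₃ f w q p,
    swap₁₂ f q p p, swap₂₃ f p q p, swap₂₃ f q p q, swap₁₂ f p q q, swap₂₃ f q p q]
  ring

/-! ### The Jacobi matrix as a Sylvester matrix -/

/-- The Jacobi matrix of `f|ℓ'` in the coordinates of the lines `ℓ'` near `span {p, q}` defined by
the transversal vectors `a` and `b`. -/
noncomputable def lineJacobian (f : MvPolynomial (Fin 4) ℝ) (a b p q : Fin 4 → ℝ) :
    Matrix (Fin 4) (Fin 4) ℝ :=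
  !![3 * cubicPolar f p p a, 0, 3 * cubicPolar f p p b, 0;
     2 * (3 * cubicPolar f p q a), 3 * cubicPolar f p p a,
       2 * (3 * cubicPolar f p q b), 3 * cubicPolar f p p b;
     3 * cubicPolar f q q a, 2 * (3 * cubicPolar f p q a),
       3 * cubicPolar f q q b, 2 * (3 * cubicPolar f p q b);
     0, 3 * cubicPolar f q q a, 0, 3 * cubicPolar f q q b]

/-- The columns are the coefficients of `u l`, `v l`, `u m`, `v m` for `l = l₁u² + 2l₂uv + l₃v²` and
`m = m₁u² + 2m₂uv + m₃v²`, so this is the classical formula for the resultant of two quadratics. -/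
lemma det_binaryQuadratic (l₁ l₂ l₃ m₁ m₂ m₃ : ℝ) :
    Matrix.det !![l₁, 0, m₁, 0; 2 * l₂, l₁, 2 * m₂, m₁; l₃, 2 * l₂, m₃, 2 * m₂; 0, l₃, 0, m₃] =
      (l₁ * m₃ - l₃ * m₁) ^ 2 - 4 * (l₁ * m₂ - l₂ * m₁) * (l₂ * m₃ - l₃ * m₂) := by
  simp [Matrix.det_succ_row_zero, Fin.sum_univ_succ, Fin.succAbove]
  ring

-- The resultant of two binary quadratics has weight 4. The exponent being even, the sign of the
-- Jacobian does not depend on the basis of the plane.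
open cubicPolar in
lemma det_lineJacobian_change (f : MvPolynomial (Fin 4) ℝ) (a b p q : Fin 4 → ℝ)
    (α β γ δ : ℝ) :
    (lineJacobian f a b (α • p + β • q) (γ • p + δ • q)).det =
      (α * δ - β * γ) ^ 4 * (lineJacobian f a b p q).det := by
  simp only [lineJacobian, det_binaryQuadratic, add₁, add₂, smul₁, smul₂, swap₁₂ f q p]
  ring

-- Displacements inside the plane of `p` and `q` contribute nothing because `f` vanishes there, so
-- only the transversal components along `a` and `b` survive.
open cubicPolar in
lemma lineCubicDeriv_eq_mulVec {f : MvPolynomial (Fin 4) ℝ} {a b p q : Fin 4 → ℝ}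
    (h : lineCubic f p q = 0) (x : Fin 4 → ℝ) (α β γ δ : ℝ) :
    lineCubicDeriv f p q (x 0 • a + x 2 • b + (α • p + β • q))
      (x 1 • a + x 3 • b + (γ • p + δ • q)) = (lineJacobian f a b p q).mulVec x := by
  have h0 : cubicPolar f p p p = 0 := by simpa [lineCubic] using congrFun h 0
  have h1 : cubicPolar f p p q = 0 := by simpa [lineCubic] using congrFun h 1
  have h2 : cubicPolar f q q p = 0 := by simpa [lineCubic] using congrFun h 2
  have h3 : cubicPolar f q q q = 0 := by simpa [lineCubic] using congrFun h 3
  have h1' : cubicPolar f p q p = 0 := by rw [swap₂₃, h1]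
  have h2' : cubicPolar f p q q = 0 := by rw [rotate, h2]
  ext i
  fin_cases i <;>
  · simp [lineCubicDeriv, lineJacobian, add₃, smul₃, h0, h1, h2, h3, h1', h2', Matrix.mulVec,
      dotProduct, Fin.sum_univ_four]
    try ring

/-! ### Nonsingularity makes the Jacobian nonzero -/

/-- Two complex binary quadratic forms with vanishing resultant have a common zero. -/
lemma exists_common_zero_of_resultant_eq_zero {a₀ a₁ a₂ b₀ b₁ b₂ : ℂ}
    (h : (a₀ * b₂ - a₂ * b₀) ^ 2 - (a₀ * b₁ - a₁ * b₀) * (a₁ * b₂ - a₂ * b₁) = 0) :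
    ∃ u v : ℂ, (u ≠ 0 ∨ v ≠ 0) ∧ a₀ * u ^ 2 + a₁ * (u * v) + a₂ * v ^ 2 = 0 ∧
      b₀ * u ^ 2 + b₁ * (u * v) + b₂ * v ^ 2 = 0 := by
  by_cases h01 : a₀ * b₁ - a₁ * b₀ = 0
  · have h02 : a₀ * b₂ - a₂ * b₀ = 0 := by simpa [h01] using h
    by_cases h12 : a₁ * b₂ - a₂ * b₁ = 0
    -- All 2×2 minors vanish, so the two forms are proportional and a zero of a nonzero one serves
    -- both.
    · have key (c₀ c₁ c₂ : ℂ) : ∃ u v : ℂ, (u ≠ 0 ∨ v ≠ 0) ∧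
          c₀ * u ^ 2 + c₁ * (u * v) + c₂ * v ^ 2 = 0 := by
        by_cases hc : c₀ = 0
        · exact ⟨1, 0, by simp, by simp [hc]⟩
        · obtain ⟨s, hs⟩ := IsAlgClosed.exists_pow_nat_eq (discrim c₀ c₁ c₂) zero_lt_two
          obtain ⟨x, hx⟩ := exists_quadratic_eq_zero hc ⟨s, by rw [← hs, sq]⟩
          exact ⟨x, 1, by simp, by linear_combination hx⟩
      by_cases ha : a₀ = 0 ∧ a₁ = 0 ∧ a₂ = 0
      · obtain ⟨u, v, huv, h0⟩ := key b₀ b₁ b₂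
        exact ⟨u, v, huv, by simp [ha], h0⟩
      · obtain ⟨u, v, huv, h0⟩ := key a₀ a₁ a₂
        refine ⟨u, v, huv, h0, ?_⟩
        by_cases h0' : a₀ = 0
        · by_cases h1' : a₁ = 0
          · have h2' : a₂ ≠ 0 := fun h2' => ha ⟨h0', h1', h2'⟩
            apply mul_left_cancel₀ h2'
            linear_combination b₂ * h0 - u ^ 2 * h02 - u * v * h12
          · apply mul_left_cancel₀ h1'
            linear_combination b₁ * h0 - u ^ 2 * h01 + v ^ 2 * h12
        · apply mul_left_cancel₀ h0'
          linear_combination b₀ * h0 + u * v * h01 + v ^ 2 * h02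
    -- The minors 01 and 02 vanish while 12 does not, which forces `a₀ = b₀ = 0`.
    · refine ⟨1, 0, by simp, ?_, ?_⟩
      · have : a₀ * (a₁ * b₂ - a₂ * b₁) = 0 := by linear_combination a₁ * h02 - a₂ * h01
        simpa [h12] using this
      · have : b₀ * (a₁ * b₂ - a₂ * b₁) = 0 := by linear_combination b₁ * h02 - b₂ * h01
        simpa [h12] using this
  -- Eliminating `u²` leaves `v` times a linear form in `u`, `v`; the witness is the zero of that
  -- linear form.
  · refine ⟨-(a₀ * b₂ - a₂ * b₀), a₀ * b₁ - a₁ * b₀, Or.inr h01, ?_, ?_⟩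
    · linear_combination a₀ * h
    · linear_combination b₀ * h

/-- The complex vector with the given real coordinates. -/
def complexVec (v : Fin 4 → ℝ) : Fin 4 → ℂ := fun i => (v i : ℂ)

lemma complexVec_add (v w : Fin 4 → ℝ) : complexVec (v + w) = complexVec v + complexVec w := by
  ext i; simp [complexVec]

lemma complexVec_smul (r : ℝ) (v : Fin 4 → ℝ) :
    complexVec (r • v) = (r : ℂ) • complexVec v := by
  ext i; simp [complexVec]

lemma cubicPolar_complexVec (f : MvPolynomial (Fin 4) ℝ) (a b c : Fin 4 → ℝ) :
    cubicPolar f (complexVec a) (complexVec b) (complexVec c) = ((cubicPolar f a b c : ℝ) : ℂ) :=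
  cubicPolar.algebraMap_comp f a b c

/-- Complex combinations of real linearly independent vectors vanish only trivially. -/
lemma eq_zero_of_smul_complexVec_add {e : Module.Basis (Fin 4) ℝ (Fin 4 → ℝ)} {i j : Fin 4}
    (hij : i ≠ j) {u v : ℂ} (h : u • complexVec (e i) + v • complexVec (e j) = 0) :
    u = 0 ∧ v = 0 := by
  have key (x y : ℝ) (hxy : x • e i + y • e j = 0) : x = 0 ∧ y = 0 := by
    have h1 := congrArg (fun w => e.repr w i) hxy
    have h2 := congrArg (fun w => e.repr w j) hxy
    simp [hij, hij.symm] at h1 h2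
    exact ⟨h1, h2⟩
  have hre := key u.re v.re (by ext k; simpa [complexVec] using congrArg Complex.re (congrFun h k))
  have him := key u.im v.im (by ext k; simpa [complexVec] using congrArg Complex.im (congrFun h k))
  exact ⟨Complex.ext hre.1 him.1, Complex.ext hre.2 him.2⟩

open cubicPolar in
/-- The Jacobian does not vanish at a line of a nonsingular surface. -/
lemma det_lineJacobian_ne_zero {f : MvPolynomial (Fin 4) ℝ} (hf : f.IsHomogeneous 3)
    (hns : IsNonsingularSurface f) (e : Module.Basis (Fin 4) ℝ (Fin 4 → ℝ))
    (h : lineCubic f (e 2) (e 3) = 0) :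
    (lineJacobian f (e 0) (e 1) (e 2) (e 3)).det ≠ 0 := by
  intro hdet
  rw [lineJacobian, det_binaryQuadratic] at hdet
  obtain ⟨u, v, huv, ha, hb⟩ := exists_common_zero_of_resultant_eq_zero
    (a₀ := (cubicPolar f (e 2) (e 2) (e 0) : ℝ)) (a₁ := 2 * (cubicPolar f (e 2) (e 3) (e 0) : ℝ))
    (a₂ := (cubicPolar f (e 3) (e 3) (e 0) : ℝ)) (b₀ := (cubicPolar f (e 2) (e 2) (e 1) : ℝ))
    (b₁ := 2 * (cubicPolar f (e 2) (e 3) (e 1) : ℝ))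
    (b₂ := (cubicPolar f (e 3) (e 3) (e 1) : ℝ)) (by
      -- The resultant has degree 4 in the entries, and each entry of `lineJacobian` carries a
      -- factor 3, hence `81 = 3⁴`.
      have := congrArg (fun r : ℝ => (r : ℂ)) hdet
      push_cast at this
      linear_combination this / 81)
  have h0 : cubicPolar f (e 2) (e 2) (e 2) = 0 := by simpa [lineCubic] using congrFun h 0
  have h1 : cubicPolar f (e 2) (e 2) (e 3) = 0 := by simpa [lineCubic] using congrFun h 1
  have h2 : cubicPolar f (e 3) (e 3) (e 2) = 0 := by simpa [lineCubic] using congrFun h 2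
  have h3 : cubicPolar f (e 3) (e 3) (e 3) = 0 := by simpa [lineCubic] using congrFun h 3
  have h1' : cubicPolar f (e 2) (e 3) (e 2) = 0 := by rw [swap₂₃, h1]
  have h2' : cubicPolar f (e 2) (e 3) (e 3) = 0 := by rw [rotate, h2]
  set z : Fin 4 → ℂ := u • complexVec (e 2) + v • complexVec (e 3) with hz
  have hz0 : z ≠ 0 := by
    intro h0
    have := eq_zero_of_smul_complexVec_add (by decide) h0
    tauto
  have hexp (w : Fin 4 → ℝ) : cubicPolar f z z (complexVec w) =
      (cubicPolar f (e 2) (e 2) w : ℝ) * u ^ 2 + 2 * (cubicPolar f (e 2) (e 3) w : ℝ) * (u * v) +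
        (cubicPolar f (e 3) (e 3) w : ℝ) * v ^ 2 := by
    simp only [hz, add₁, add₂, smul₁, smul₂, cubicPolar_complexVec, swap₁₂ f (e 3) (e 2)]
    ring
  -- The derivatives along `e 0` and `e 1` vanish by the choice of `(u, v)`, those along `e 2` and
  -- `e 3` because `f` vanishes on the line.
  have hbasis (i : Fin 4) : cubicPolar f z z (complexVec (e i)) = 0 := by
    fin_cases i
    · exact (hexp _).trans ha
    · exact (hexp _).trans hb
    · simp [hexp, h0, h1', h2]
    · simp [hexp, h1, h2', h3]
  have hall (w : Fin 4 → ℝ) : cubicPolar f z z (complexVec w) = 0 := by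
    rw [← e.sum_repr w]
    simp only [Fin.sum_univ_four, complexVec_add, complexVec_smul, add₃, smul₃, hbasis]
    simp
  obtain ⟨i, hi⟩ := hns z hz0 (by
    rw [aeval_eq hf]
    conv_lhs => enter [4]; rw [hz]
    simp only [add₃, smul₃, hall]
    simp)
  apply hi
  have : (Pi.single i 1 : Fin 4 → ℂ) = complexVec (Pi.single i 1) := by
    ext j
    by_cases hij : j = i <;> simp [complexVec, hij]
  rw [aeval_pderiv hf, this, hall, mul_zero]

/-! ### Segre coordinates, the form and its discriminant -/

namespace SegreCoordinates

variable {f : MvPolynomial (Fin 4) ℝ} {ℓ : Submodule ℝ (Fin 4 → ℝ)}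

lemma eval_line_eq_zero (hℓ : ℓ ∈ realLines f) (S : SegreCoordinates f ℓ) (u v : ℝ) :
    MvPolynomial.eval (u • S.e 2 + v • S.e 3) f = 0 := by
  refine hℓ.2 _ (S.line_eq.ge ?_)
  exact Submodule.mem_span_pair.2 ⟨u, v, rfl⟩

lemma lineCubic_eq_zero (hf : f.IsHomogeneous 3) (hℓ : ℓ ∈ realLines f)
    (S : SegreCoordinates f ℓ) : lineCubic f (S.e 2) (S.e 3) = 0 :=
  _root_.lineCubic_eq_zero hf (S.eval_line_eq_zero hℓ)

/-- Segre's shape and the Taylor expansion are polynomials of degree at most 2 in `u`, `v`; six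
values of `(u, v)` separate their coefficients. -/
lemma coeff_eq (hf : f.IsHomogeneous 3) (hℓ : ℓ ∈ realLines f)
    (S : SegreCoordinates f ℓ) (x y : ℝ) :
    S.L₁₁ ![x, y] = 3 * cubicPolar f (S.e 2) (S.e 2) (x • S.e 0 + y • S.e 1) ∧
    S.L₁₂ ![x, y] = 3 * cubicPolar f (S.e 2) (S.e 3) (x • S.e 0 + y • S.e 1) ∧
    S.L₂₂ ![x, y] = 3 * cubicPolar f (S.e 3) (S.e 3) (x • S.e 0 + y • S.e 1) := by
  have key (u v : ℝ) := (eval_add_smul_add_smul hf (x • S.e 0 + y • S.e 1) (S.e 2) (S.e 3)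
    u v).symm.trans (S.shape x y u v)
  simp only [S.eval_line_eq_zero hℓ, add_zero] at key
  have k00 := key 0 0
  have k10 := key 1 0
  have k20 := key (-1) 0
  have k01 := key 0 1
  have k02 := key 0 (-1)
  have k11 := key 1 1
  norm_num at k00 k10 k20 k01 k02 k11
  refine ⟨?_, ?_, ?_⟩ <;> linarith

lemma jacobian_eq (hf : f.IsHomogeneous 3) (hℓ : ℓ ∈ realLines f) (S : SegreCoordinates f ℓ) :
    S.jacobian = lineJacobian f (S.e 0) (S.e 1) (S.e 2) (S.e 3) := by
  obtain ⟨h1, h2, h3⟩ := S.coeff_eq hf hℓ 1 0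
  obtain ⟨h4, h5, h6⟩ := S.coeff_eq hf hℓ 0 1
  simp only [one_smul, zero_smul, add_zero, zero_add] at h1 h2 h3 h4 h5 h6
  simp only [jacobian, lineJacobian, h1, h2, h3, h4, h5, h6]

lemma linear_apply (L : (Fin 2 → ℝ) →ₗ[ℝ] ℝ) (a : Fin 2 → ℝ) :
    L a = a 0 * L ![1, 0] + a 1 * L ![0, 1] := by
  conv_lhs => rw [show a = a 0 • ![1, 0] + a 1 • ![0, 1] by ext i; fin_cases i <;> simp]
  simp only [map_add, map_smul, smul_eq_mul]

lemma form_apply (S : SegreCoordinates f ℓ) (a : Fin 2 → ℝ) :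
    S.form a = S.L₁₂ a * S.L₁₂ a - S.L₁₁ a * S.L₂₂ a := by
  simp [form]

/-- `QuadraticForm.discr'` is the determinant `AC - B²/4` of the symmetric matrix, which accounts
for the factor 4. -/
lemma det_jacobian (S : SegreCoordinates f ℓ) :
    S.jacobian.det = -(4 * QuadraticForm.discr' S.form) := by
  have h (i j : Fin 2) : S.form.toMatrix' i j = (S.form (Pi.single i 1 + Pi.single j 1)
      - S.form (Pi.single i 1) - S.form (Pi.single j 1)) / 2 := by
    rw [QuadraticForm.toMatrix', LinearMap.toMatrix₂'_apply, QuadraticMap.associated_apply]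
    simp
    ring
  rw [QuadraticForm.discr', Matrix.det_fin_two, h, h, h, h, jacobian, det_binaryQuadratic]
  simp only [form_apply, linear_apply S.L₁₁ (_ + _), linear_apply S.L₁₂ (_ + _),
    linear_apply S.L₂₂ (_ + _), linear_apply S.L₁₁ (Pi.single _ _),
    linear_apply S.L₁₂ (Pi.single _ _), linear_apply S.L₂₂ (Pi.single _ _)]
  simp
  ring

/-- The value of the form in terms of its three coefficients. -/
lemma exists_coeff_form (S : SegreCoordinates f ℓ) :
    ∃ A B C : ℝ, (∀ a, S.form a = A * a 0 ^ 2 + B * (a 0 * a 1) + C * a 1 ^ 2) ∧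
      S.jacobian.det = B ^ 2 - 4 * A * C := by
  refine ⟨S.L₁₂ ![1, 0] ^ 2 - S.L₁₁ ![1, 0] * S.L₂₂ ![1, 0],
    2 * S.L₁₂ ![1, 0] * S.L₁₂ ![0, 1] - S.L₁₁ ![1, 0] * S.L₂₂ ![0, 1]
      - S.L₁₁ ![0, 1] * S.L₂₂ ![1, 0],
    S.L₁₂ ![0, 1] ^ 2 - S.L₁₁ ![0, 1] * S.L₂₂ ![0, 1], fun a => ?_, ?_⟩
  · rw [form_apply, linear_apply S.L₁₁ a, linear_apply S.L₁₂ a, linear_apply S.L₂₂ a]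
    ring
  · rw [jacobian, det_binaryQuadratic]
    ring

lemma not_isIndefiniteForm_and_isDefiniteForm {q : QuadraticForm ℝ (Fin 2 → ℝ)}
    (h : IsIndefiniteForm q) : ¬ IsDefiniteForm q := by
  obtain ⟨⟨a, ha⟩, b, hb⟩ := h
  rintro (h | h)
  · exact absurd (h b (by rintro rfl; simp at hb)) hb.not_gt
  · have := h a (by rintro rfl; simp at ha)
    simp at this
    exact absurd this ha.not_gt

lemma isIndefiniteForm_of_pos (S : SegreCoordinates f ℓ) (h : 0 < S.jacobian.det) :
    IsIndefiniteForm S.form := by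
  obtain ⟨A, B, C, hq, hd⟩ := S.exists_coeff_form
  rw [hd] at h
  rcases lt_trichotomy A 0 with hA | hA | hA
  -- The value at `(-B, 2A)` is `-A (B² - 4AC)`, of sign opposite to the value `A` at `(1, 0)`.
  · refine ⟨⟨![-B, 2 * A], ?_⟩, ![1, 0], ?_⟩
    · rw [hq]; simp; nlinarith [mul_pos_of_neg_of_neg hA (neg_neg_of_pos h)]
    · rw [hq]; simpa
  · subst hA
    have hB : B ≠ 0 := by rintro rfl; simp at h
    -- With `A = 0` the form at `(t, 1)` is `B t + C`; the two witnesses give the values `1` and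
    -- `-1`.
    refine ⟨⟨![(1 - C) / B, 1], ?_⟩, ![(-1 - C) / B, 1], ?_⟩ <;>
    · rw [hq]; simp; field_simp; simp
  · refine ⟨⟨![1, 0], ?_⟩, ![-B, 2 * A], ?_⟩
    · rw [hq]; simpa
    · rw [hq]; simp; nlinarith [mul_pos hA h]

/-- Completing the square in `4A q` shows that `A q` is positive away from the origin; `A = 0` is
excluded since the discriminant would be `B² ≥ 0`. -/
lemma isDefiniteForm_of_neg (S : SegreCoordinates f ℓ) (h : S.jacobian.det < 0) :
    IsDefiniteForm S.form := by
  obtain ⟨A, B, C, hq, hd⟩ := S.exists_coeff_form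
  rw [hd] at h
  have key (a : Fin 2 → ℝ) (ha : a ≠ 0) : 0 < A * S.form a := by
    have h1 : 4 * (A * S.form a) = (2 * A * a 0 + B * a 1) ^ 2 - (B ^ 2 - 4 * A * C) * a 1 ^ 2 := by
      rw [hq]; ring
    by_cases h0 : a 1 = 0
    · have h2 : a 0 ≠ 0 := fun h2 => ha (by ext i; fin_cases i <;> simp [h0, h2])
      have hA : A ≠ 0 := by rintro rfl; nlinarith [sq_nonneg B]
      rw [hq, h0]
      have : 0 < (A * a 0) ^ 2 := by positivity
      linarith
    · have : 0 < a 1 ^ 2 := by positivity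
      nlinarith [sq_nonneg (2 * A * a 0 + B * a 1)]
  rcases lt_trichotomy A 0 with hA | hA | hA
  · exact Or.inr fun a ha => by
      have := key a ha
      simp only [neg_apply]
      nlinarith
  · subst hA
    nlinarith [sq_nonneg B]
  · exact Or.inl fun a ha => (pos_iff_pos_of_mul_pos (key a ha)).1 hA

lemma isIndefiniteForm_iff (S : SegreCoordinates f ℓ) (h : S.jacobian.det ≠ 0) :
    IsIndefiniteForm S.form ↔ 0 < S.jacobian.det :=
  ⟨fun hi => h.lt_or_gt.resolve_left fun hn =>
    not_isIndefiniteForm_and_isDefiniteForm hi (S.isDefiniteForm_of_neg hn),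
    S.isIndefiniteForm_of_pos⟩

lemma isDefiniteForm_iff (S : SegreCoordinates f ℓ) (h : S.jacobian.det ≠ 0) :
    IsDefiniteForm S.form ↔ S.jacobian.det < 0 :=
  ⟨fun hi => h.lt_or_gt.resolve_right fun hn =>
    not_isIndefiniteForm_and_isDefiniteForm (S.isIndefiniteForm_of_pos hn) hi,
    S.isDefiniteForm_of_neg⟩

/-- The expression of the section in the coordinates of `S`, and its derivative. -/
lemma exists_isSectionInCoordinates (hf : f.IsHomogeneous 3) (hℓ : ℓ ∈ realLines f)
    (S : SegreCoordinates f ℓ) :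
    ∃ c : (Fin 4 → ℝ) → (Fin 4 → ℝ), S.IsSectionInCoordinates c ∧
      HasFDerivAt c (Matrix.toLin' S.jacobian).toContinuousLinearMap 0 := by
  let pr (i : Fin 4) : (Fin 4 → ℝ) →L[ℝ] ℝ := ContinuousLinearMap.proj i
  let P : (Fin 4 → ℝ) →L[ℝ] (Fin 4 → ℝ) := (pr 0).smulRight (S.e 0) + (pr 2).smulRight (S.e 1)
  let Q : (Fin 4 → ℝ) →L[ℝ] (Fin 4 → ℝ) := (pr 1).smulRight (S.e 0) + (pr 3).smulRight (S.e 1)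
  obtain ⟨D, hD, hD'⟩ := HasFDerivAt.lineCubic f
    ((P.hasFDerivAt (x := 0)).add_const (S.e 2)) ((Q.hasFDerivAt (x := 0)).add_const (S.e 3))
  refine ⟨_, fun a u v => eval_smul_add_smul hf _ _ u v, ?_⟩
  convert! hD using 1
  ext1 x
  rw [hD', map_zero, map_zero, zero_add, zero_add]
  have := lineCubicDeriv_eq_mulVec (a := S.e 0) (b := S.e 1) (S.lineCubic_eq_zero hf hℓ) x 0 0 0 0
  simp only [zero_smul, add_zero] at this
  simp only [LinearMap.coe_toContinuousLinearMap', Matrix.toLin'_apply, S.jacobian_eq hf hℓ]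
  exact this.symm

end SegreCoordinates

/-! ### Local degree at a nondegenerate zero -/

/-- A continuously differentiable map has local degree `± 1` at a zero with invertible
derivative. -/
lemma hasLocalDegree_of_det_ne_zero {E : Type*} [NormedAddCommGroup E] [NormedSpace ℝ E]
    [FiniteDimensional ℝ E] {g : E → E} {x : E} (hg : ContDiff ℝ 1 g) (h0 : g x = 0)
    (hdet : (fderiv ℝ g x).det ≠ 0) :
    HasLocalDegree g x ((SignType.sign (fderiv ℝ g x).det : SignType) : ℤ) := by
  have : CompleteSpace E := FiniteDimensional.complete ℝ E
  have hs : HasStrictFDerivAt g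
      (((fderiv ℝ g x).toContinuousLinearEquivOfDetNeZero hdet : E ≃L[ℝ] E) : E →L[ℝ] E) x := by
    rw [ContinuousLinearMap.coe_toContinuousLinearEquivOfDetNeZero]
    exact hg.contDiffAt.hasStrictFDerivAt one_ne_zero
  have hcont : Continuous fun y => (fderiv ℝ g y).det * (fderiv ℝ g x).det :=
    (ContinuousLinearMap.continuous_det.comp (hg.continuous_fderiv one_ne_zero)).mul
      continuous_const
  have hsign : ∀ᶠ y in nhds x, 0 < (fderiv ℝ g y).det * (fderiv ℝ g x).det :=
    hcont.continuousAt.eventually (lt_mem_nhds (mul_self_pos.2 hdet))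
  have hsource := (hs.toOpenPartialHomeomorph g).open_source.mem_nhds
    hs.mem_toOpenPartialHomeomorph_source
  -- On this ball `g` is injective, by the inverse function theorem, and its Jacobian keeps its
  -- sign, so each small value has exactly one preimage, counted with that sign.
  obtain ⟨r, hr, hball⟩ := Metric.nhds_basis_closedBall.mem_iff.1 (Filter.inter_mem hsource hsign)
  have hinj {y z : E} (hy : y ∈ Metric.closedBall x r) (hz : z ∈ Metric.closedBall x r)
      (hyz : g y = g z) : y = z :=
    (hs.toOpenPartialHomeomorph g).injOn (hball hy).1 (hball hz).1 hyz
  have himg : g '' Metric.closedBall x r ∈ nhds (0 : E) := by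
    rw [← h0, ← hs.map_nhds_eq_of_equiv]
    exact Filter.image_mem_map (Metric.closedBall_mem_nhds x hr)
  obtain ⟨ε, hε, hεball⟩ := Metric.mem_nhds_iff.1 himg
  refine ⟨r, hr, fun y _ => hg.contDiffAt, fun y hy => ⟨fun h => ?_, fun h => h ▸ h0⟩, ε, hε,
    fun c hc _ => ?_⟩
  · exact hinj hy (Metric.mem_closedBall_self hr.le) (h.trans h0.symm)
  · obtain ⟨y, hy, rfl⟩ := hεball (mem_ball_zero_iff.2 hc)
    have hset : {z ∈ Metric.closedBall x r | g z = g y} = {y} := by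
      ext z
      exact ⟨fun h => hinj h.1 hy h.2, fun h => by rw [h]; exact ⟨hy, rfl⟩⟩
    rw [hset]
    refine ⟨Set.finite_singleton y, ?_⟩
    rw [finsum_mem_singleton]
    have h1 : 0 < (fderiv ℝ g y).det * (fderiv ℝ g x).det := (hball hy).2
    rcases hdet.lt_or_gt with h | h
    · rw [sign_neg h, sign_neg (neg_of_mul_pos_left h1 h.le)]
    · rw [sign_pos h, sign_pos (pos_of_mul_pos_left h1 h.le)]

/-- The value `0` is itself regular, its only preimage in the ball being `x`, so it may be used to
compute the degree. -/
lemma HasLocalDegree.eq_sign {E : Type*} [NormedAddCommGroup E] [NormedSpace ℝ E]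
    {g : E → E} {x : E} {d : ℤ} (h : HasLocalDegree g x d) (hdet : (fderiv ℝ g x).det ≠ 0) :
    d = ((SignType.sign (fderiv ℝ g x).det : SignType) : ℤ) := by
  obtain ⟨r, hr, -, hz, ε, hε, hc⟩ := h
  have hset : {y ∈ Metric.closedBall x r | g y = 0} = {x} := by
    ext y
    refine ⟨fun h => (hz y h.1).1 h.2, fun h => ?_⟩
    rw [h]
    exact ⟨Metric.mem_closedBall_self hr.le, (hz x (Metric.mem_closedBall_self hr.le)).2 rfl⟩
  have h2 := (hc 0 (by simpa) fun y hy h0 => by rwa [(hz y hy).1 h0]).2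
  rwa [hset, finsum_mem_singleton, eq_comm] at h2

/-! ### Complex orientations against real coordinates -/

/-- The coefficients of the real binary cubic form `Re (α z³ + β z² z̄)` in `z = u + i v`. -/
noncomputable def complexCubicCoeff : (ℂ × ℂ) ≃ₗ[ℝ] (Fin 4 → ℝ) where
  toFun g := ![g.1.re + g.2.re, -3 * g.1.im - g.2.im, -3 * g.1.re + g.2.re, g.1.im - g.2.im]
  invFun c := (⟨(c 0 - c 2) / 4, (c 3 - c 1) / 4⟩, ⟨(3 * c 0 + c 2) / 4, -(c 1 + 3 * c 3) / 4⟩)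
  map_add' g h := by ext i; fin_cases i <;> simp <;> ring
  map_smul' r g := by ext i; fin_cases i <;> simp <;> ring
  left_inv g := by ext <;> simp <;> ring_nf
  right_inv c := by ext i; fin_cases i <;> simp <;> ring_nf

lemma complexCubicCoeff_symm_apply (c : Fin 4 → ℝ) : complexCubicCoeff.symm c =
    (⟨(c 0 - c 2) / 4, (c 3 - c 1) / 4⟩, ⟨(3 * c 0 + c 2) / 4, -(c 1 + 3 * c 3) / 4⟩) := rfl

lemma re_complexCubic (g : ℂ × ℂ) (z : ℂ) :
    (g.1 * z ^ 3 + g.2 * (z ^ 2 * (starRingEnd ℂ) z)).re =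
      complexCubicCoeff g 0 * z.re ^ 3 + complexCubicCoeff g 1 * (z.re ^ 2 * z.im) +
        complexCubicCoeff g 2 * (z.re * z.im ^ 2) + complexCubicCoeff g 3 * z.im ^ 3 := by
  simp [complexCubicCoeff, pow_succ]
  ring

/-- The coordinates `x₁, x₂, y₁, y₂` for which `Re (ξ z) = u x₁ + v x₂` and `Re (υ z) = u y₁ + v y₂`,
where `z = u + i v`. -/
def realPairCoord : (ℂ × ℂ) ≃ₗ[ℝ] (Fin 4 → ℝ) where
  toFun g := ![g.1.re, -g.1.im, g.2.re, -g.2.im]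
  invFun c := (⟨c 0, -c 1⟩, ⟨c 2, -c 3⟩)
  map_add' g h := by ext i; fin_cases i <;> simp <;> ring
  map_smul' r g := by ext i; fin_cases i <;> simp
  left_inv g := by ext <;> simp
  right_inv c := by ext i; fin_cases i <;> simp

/-- Positivity is what matters: the real coordinates of the lines and the frame `u³, u²v, uv², v³`
compare consistently with the complex orientations. Otherwise the two indices would be exchanged. -/
lemma det_realPairCoord_comp_symm :
    LinearMap.det (realPairCoord.toLinearMap ∘ₗ complexCubicCoeff.symm.toLinearMap) = 1 / 16 := by
  rw [← LinearMap.det_toMatrix']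
  have : LinearMap.toMatrix' (realPairCoord.toLinearMap ∘ₗ complexCubicCoeff.symm.toLinearMap) =
      !![1 / 4, 0, -1 / 4, 0; 0, 1 / 4, 0, -1 / 4; 3 / 4, 0, 1 / 4, 0; 0, 1 / 4, 0, 3 / 4] := by
    ext i j
    rw [LinearMap.toMatrix'_apply]
    fin_cases i <;> fin_cases j <;>
      simp [realPairCoord, complexCubicCoeff_symm_apply] <;> norm_num
  rw [this]
  simp [Matrix.det_succ_row_zero, Fin.sum_univ_succ, Fin.succAbove]
  norm_num

/-- The complex orientations: a complex automorphism of `ℂ²`, followed by the real linear map with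
matrix `J`, read in the two systems of real coordinates. -/
lemma det_symm_comp_toLin'_comp (J : Matrix (Fin 4) (Fin 4) ℝ) (A : (ℂ × ℂ) →ₗ[ℂ] ℂ × ℂ) :
    LinearMap.det (complexCubicCoeff.symm.toLinearMap ∘ₗ Matrix.toLin' J ∘ₗ
      realPairCoord.toLinearMap ∘ₗ A.restrictScalars ℝ) =
      Complex.normSq (LinearMap.det A) / 16 * J.det := by
  -- Moved to `ℝ⁴`, the map factors into `J`, the map `A` in real coordinates, and the comparison of
  -- the two coordinate systems. Over `ℝ` the determinant of `A` becomes the squared modulus of the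
  -- complex one.
  rw [← LinearMap.det_conj _ complexCubicCoeff]
  have : complexCubicCoeff.toLinearMap ∘ₗ (complexCubicCoeff.symm.toLinearMap ∘ₗ
      Matrix.toLin' J ∘ₗ realPairCoord.toLinearMap ∘ₗ A.restrictScalars ℝ) ∘ₗ
        complexCubicCoeff.symm.toLinearMap = Matrix.toLin' J ∘ₗ
      (realPairCoord.toLinearMap ∘ₗ A.restrictScalars ℝ ∘ₗ realPairCoord.symm.toLinearMap) ∘ₗ
      (realPairCoord.toLinearMap ∘ₗ complexCubicCoeff.symm.toLinearMap) := by
    exact LinearMap.ext fun x => by simp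
  rw [this, LinearMap.det_comp, LinearMap.det_comp, LinearMap.det_conj, LinearMap.det_toLin',
    det_realPairCoord_comp_symm, LinearMap.det_restrictScalars, Algebra.norm_complex_eq]
  change J.det * (Complex.normSq _ * (1 / 16)) = _
  ring

/-- The real part of a complex vector. -/
noncomputable def reVec : (Fin 4 → ℂ) →L[ℝ] (Fin 4 → ℝ) :=
  ContinuousLinearMap.pi fun i => Complex.reCLM.comp (ContinuousLinearMap.proj i)

/-- The imaginary part of a complex vector. -/
noncomputable def imVec : (Fin 4 → ℂ) →L[ℝ] (Fin 4 → ℝ) :=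
  ContinuousLinearMap.pi fun i => Complex.imCLM.comp (ContinuousLinearMap.proj i)

@[simp] lemma reVec_apply (z : Fin 4 → ℂ) (i : Fin 4) : reVec z i = (z i).re := rfl

@[simp] lemma imVec_apply (z : Fin 4 → ℂ) (i : Fin 4) : imVec z i = (z i).im := rfl

lemma polarParam_eq (w : Fin 4 → ℂ) (z : ℂ) :
    polarParam w z = z.re • reVec w + z.im • (-imVec w) := by
  ext i
  simp [polarParam]
  ring

lemma polarPlane_eq (w : Fin 4 → ℂ) : polarPlane w = Submodule.span ℝ {reVec w, -imVec w} := by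
  ext v
  rw [Submodule.mem_span_pair, polarPlane, LinearMap.mem_range]
  constructor
  · rintro ⟨z, rfl⟩
    exact ⟨z.re, z.im, (polarParam_eq w z).symm⟩
  · rintro ⟨a, b, rfl⟩
    exact ⟨⟨a, b⟩, polarParam_eq w _⟩

/-- The complex linear extension of a real linear coordinate. -/
noncomputable def complexCoord (φ : (Fin 4 → ℝ) →ₗ[ℝ] ℝ) : (Fin 4 → ℂ) →ₗ[ℂ] ℂ where
  toFun z := ⟨φ (reVec z), φ (imVec z)⟩
  map_add' z z' := by
    simp only [map_add]
    rfl
  map_smul' c z := by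
    have h1 : reVec (c • z) = c.re • reVec z - c.im • imVec z := by ext i; simp
    have h2 : imVec (c • z) = c.re • imVec z + c.im • reVec z := by ext i; simp
    apply Complex.ext <;> simp [h1, h2]

/-- Two bases of a plane are related by an invertible matrix. -/
lemma exists_change_of_span_eq {e : Module.Basis (Fin 4) ℝ (Fin 4 → ℝ)} {p q : Fin 4 → ℝ}
    (h : Submodule.span ℝ {p, q} = Submodule.span ℝ {e 2, e 3}) :
    (∃ a b c d : ℝ, p = a • e 2 + b • e 3 ∧ q = c • e 2 + d • e 3 ∧ a * d - b * c ≠ 0) ∧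
      ∃ a b c d : ℝ, e 2 = a • p + b • q ∧ e 3 = c • p + d • q := by
  obtain ⟨a, b, hp⟩ := Submodule.mem_span_pair.1 (h.le (Submodule.subset_span (by simp : p ∈ _)))
  obtain ⟨c, d, hq⟩ := Submodule.mem_span_pair.1 (h.le (Submodule.subset_span (by simp : q ∈ _)))
  obtain ⟨a', b', h2⟩ :=
    Submodule.mem_span_pair.1 (h.ge (Submodule.subset_span (by simp : e 2 ∈ _)))
  obtain ⟨c', d', h3⟩ :=
    Submodule.mem_span_pair.1 (h.ge (Submodule.subset_span (by simp : e 3 ∈ _)))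
  refine ⟨⟨a, b, c, d, hp.symm, hq.symm, fun h0 => ?_⟩, a', b', c', d', h2.symm, h3.symm⟩
  rw [← hp, ← hq] at h2 h3
  have k1 := congrArg (fun w => e.repr w 2) h2
  have k2 := congrArg (fun w => e.repr w 3) h2
  have k3 := congrArg (fun w => e.repr w 2) h3
  have k4 := congrArg (fun w => e.repr w 3) h3
  simp at k1 k2 k3 k4
  have : (a' * d' - b' * c') * (a * d - b * c) = 1 := by
    linear_combination (c' * b + d' * d) * k1 + k4 - (c' * a + d' * c) * k2
  rw [h0, mul_zero] at this
  exact zero_ne_one this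

/-- The plane of `w` is parametrized by `u Re w + v (-Im w)` for `z = u + i v`, so the expression of
the section in a chart is forced. -/
lemma lineCubic_eq_complexCubicCoeff {f : MvPolynomial (Fin 4) ℝ} (hf : f.IsHomogeneous 3)
    {w : Fin 4 → ℂ} {g : ℂ × ℂ} :
    (∀ z : ℂ, MvPolynomial.eval (polarParam w z) f =
      (g.1 * z ^ 3 + g.2 * (z ^ 2 * (starRingEnd ℂ) z)).re) ↔
      g = complexCubicCoeff.symm (lineCubic f (reVec w) (-imVec w)) := by
  rw [LinearEquiv.eq_symm_apply]
  simp only [polarParam_eq, eval_smul_add_smul hf, re_complexCubic]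
  constructor
  · exact fun h => binaryCubic_coeff_ext fun u v => (h ⟨u, v⟩).symm
  · rintro h z
    rw [h]

/-! ### The section in a polar chart -/

section Chart

variable {f : MvPolynomial (Fin 4) ℝ} {w : ℂ × ℂ → (Fin 4 → ℂ)}
  {e : Module.Basis (Fin 4) ℝ (Fin 4 → ℝ)}

/-- The differential of a polar chart, read in complex coordinates transversal to the plane. -/
noncomputable def transversalDeriv (e : Module.Basis (Fin 4) ℝ (Fin 4 → ℝ))
    (W : (ℂ × ℂ) →L[ℂ] (Fin 4 → ℂ)) : (ℂ × ℂ) →ₗ[ℂ] ℂ × ℂ :=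
  ((complexCoord (e.coord 0)).prod (complexCoord (e.coord 1))) ∘ₗ W.toLinearMap

lemma sum_mul_fderiv_eq_zero (hw : DifferentiableAt ℂ w 0)
    (hq : ∀ᶠ ζ in nhds (0 : ℂ × ℂ), ∑ i, w ζ i ^ 2 = 0) (η : ℂ × ℂ) :
    ∑ i, w 0 i * fderiv ℂ w 0 η i = 0 := by
  have h1 := hasFDerivAt_pi'.1 hw.hasFDerivAt
  have h2 : HasFDerivAt (fun ζ => ∑ i, w ζ i ^ 2) _ 0 :=
    HasFDerivAt.fun_sum fun i _ => (h1 i).pow 2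
  have h3 : HasFDerivAt (fun ζ => ∑ i, w ζ i ^ 2) (0 : (ℂ × ℂ) →L[ℂ] ℂ) 0 :=
    (hasFDerivAt_const (0 : ℂ) (0 : ℂ × ℂ)).congr_of_eventuallyEq hq
  have h4 := congrArg (fun D : (ℂ × ℂ) →L[ℂ] ℂ => D η) (h2.unique h3)
  simp only [sum_apply, smul_apply, ContinuousLinearMap.comp_apply,
    ContinuousLinearMap.proj_apply, zero_apply, smul_eq_mul] at h4
  have h5 : 2 * ∑ i, w 0 i * fderiv ℂ w 0 η i = 0 := by
    rw [← h4, Finset.mul_sum]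
    exact Finset.sum_congr rfl fun i _ => by simp; ring
  simpa using h5

/-- The polar correspondence is an immersion. If the transversal part of `ω = dw(η)` vanishes, then
`ω` lies in the complex span of `p`, `q`, where `w 0 = p - i q`. The quadric equation makes `p`, `q`
orthogonal of equal length, and `ω` is orthogonal to `w 0` for the bilinear form; hence `ω` is a
multiple of `w 0`, and regularity of the chart gives `η = 0`. -/
lemma det_transversalDeriv_ne_zero (hw : IsPolarChart (Submodule.span ℝ {e 2, e 3}) w) :
    LinearMap.det (transversalDeriv e (fderiv ℂ w 0)) ≠ 0 := by
  intro hdet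
  have hker := LinearMap.bot_lt_ker_of_det_eq_zero hdet
  obtain ⟨η, hη, hη0⟩ := Submodule.exists_mem_ne_zero_of_ne_bot hker.ne'
  apply hη0
  have hη' : transversalDeriv e (fderiv ℂ w 0) η = 0 := hη
  set ω := fderiv ℂ w 0 η with hω
  set p := reVec (w 0)
  set q := -imVec (w 0) with hq
  have hspan : Submodule.span ℝ {p, q} = Submodule.span ℝ {e 2, e 3} := by
    rw [← hw.center, polarPlane_eq]
  obtain ⟨-, a, b, c, d, h2, h3⟩ := exists_change_of_span_eq hspan
  have h0 : complexCoord (e.coord 0) ω = 0 := congrArg Prod.fst hη'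
  have h1 : complexCoord (e.coord 1) ω = 0 := congrArg Prod.snd hη'
  have hcoord (v : Fin 4 → ℝ) (h0 : e.coord 0 v = 0) (h1 : e.coord 1 v = 0) :
      ∃ x y : ℝ, v = x • p + y • q := by
    refine ⟨e.repr v 2 * a + e.repr v 3 * c, e.repr v 2 * b + e.repr v 3 * d, ?_⟩
    conv_lhs => rw [← e.sum_repr v]
    rw [Module.Basis.coord_apply] at h0 h1
    simp only [Fin.sum_univ_four, h0, h1, h2, h3]
    module
  obtain ⟨x, y, hre⟩ := hcoord _ (congrArg Complex.re h0) (congrArg Complex.re h1)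
  obtain ⟨x', y', him⟩ := hcoord _ (congrArg Complex.im h0) (congrArg Complex.im h1)
  have hωi (i) : ω i = (x + x' * Complex.I) * p i + (y + y' * Complex.I) * q i := by
    have hr := congrFun hre i
    have hi := congrFun him i
    apply Complex.ext
    · simpa using hr
    · simpa [add_comm] using hi
  have hwi (i) : w 0 i = p i - q i * Complex.I := by
    apply Complex.ext <;> simp [p, q]
  have hww : ∑ i, w 0 i ^ 2 = 0 := hw.mem_quadric.self_of_nhds
  have hpq1 : (∑ i, p i ^ 2) - ∑ i, q i ^ 2 = 0 := by
    have := congrArg Complex.re hww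
    simp only [hwi, Fin.sum_univ_four, sq] at this ⊢
    simp at this
    linarith
  have hpq2 : ∑ i, p i * q i = 0 := by
    have := congrArg Complex.im hww
    simp only [hwi, Fin.sum_univ_four, sq] at this ⊢
    simp at this
    linarith
  have hp0 : ∑ i, p i ^ 2 ≠ 0 := by
    intro h
    have hp : p = 0 := by
      ext i
      have := (Finset.sum_eq_zero_iff_of_nonneg fun i _ => sq_nonneg (p i)).1 h i
        (Finset.mem_univ i)
      simpa using this
    have hq : q = 0 := by
      ext i
      have := (Finset.sum_eq_zero_iff_of_nonneg fun i _ => sq_nonneg (q i)).1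
        (by linarith) i (Finset.mem_univ i)
      simpa using this
    refine e.ne_zero 2 ?_
    rw [h2, hp, hq]
    simp
  have hwω : ∑ i, w 0 i * ω i = 0 :=
    sum_mul_fderiv_eq_zero hw.holomorphic.differentiableAt hw.mem_quadric η
  have hxy : ((x : ℂ) + x' * Complex.I) - (y + y' * Complex.I) * Complex.I = 0 := by
    have h1 : ∑ i, w 0 i * ω i = ((x : ℂ) + x' * Complex.I - (y + y' * Complex.I) * Complex.I) *
        (∑ i, p i ^ 2 : ℝ) + (y + y' * Complex.I) * Complex.I *
          (((∑ i, p i ^ 2) - ∑ i, q i ^ 2 : ℝ)) +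
        ((y + y' * Complex.I) - (x + x' * Complex.I) * Complex.I) * (∑ i, p i * q i : ℝ) := by
      simp only [hwi, hωi, Fin.sum_univ_four]
      push_cast
      ring
    rw [hwω, hpq1, hpq2] at h1
    simpa [hp0, ← Complex.ofReal_pow, ← Complex.ofReal_sum] using h1.symm
  have hlin := Fintype.linearIndependent_iff.1 hw.regular
    ![(y + y' * Complex.I) * Complex.I, -η.1, -η.2] (by
      have hη12 : ω = η.1 • fderiv ℂ w 0 (1, 0) + η.2 • fderiv ℂ w 0 (0, 1) := by
        rw [hω, ← map_smul, ← map_smul, ← map_add]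
        simp
      have hω2 : ω = ((y + y' * Complex.I) * Complex.I) • w 0 := by
        ext i
        rw [hωi, Pi.smul_apply, smul_eq_mul, hwi]
        linear_combination (p i : ℂ) * hxy + (y + y' * Complex.I) * q i * Complex.I_sq
      simp only [Fin.sum_univ_three, Matrix.cons_val]
      rw [← hω2, hη12]
      module)
  have e1 := hlin 1
  have e2 := hlin 2
  simp at e1 e2
  exact Prod.ext e1 e2

/-- The derivative of the section of `Sym³` in complex coordinates is, up to orientation preserving
factors, the Jacobi matrix in real coordinates. -/
lemma exists_hasFDerivAt_section (hf : f.IsHomogeneous 3) (hℓ : lineCubic f (e 2) (e 3) = 0)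
    (hw : IsPolarChart (Submodule.span ℝ {e 2, e 3}) w) :
    ∃ D : (ℂ × ℂ) →L[ℝ] ℂ × ℂ, HasFDerivAt (fun ζ =>
        complexCubicCoeff.symm (lineCubic f (reVec (w ζ)) (-imVec (w ζ)))) D 0 ∧
      ∃ r : ℝ, 0 < r ∧ D.det = r * (lineJacobian f (e 0) (e 1) (e 2) (e 3)).det := by
  have hW := hw.holomorphic.differentiableAt.hasFDerivAt.restrictScalars ℝ
  set W := fderiv ℂ w 0 with hWdef
  set p := reVec (w 0) with hp
  set q := -imVec (w 0) with hq
  have hspan : Submodule.span ℝ {p, q} = Submodule.span ℝ {e 2, e 3} := by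
    rw [← hw.center, polarPlane_eq]
  obtain ⟨⟨α, β, γ, δ, hpe, hqe, hαδ⟩, a, b, c, d, h2, h3⟩ := exists_change_of_span_eq hspan
  have hpq0 : lineCubic f p q = 0 := by
    refine lineCubic_eq_zero hf fun u v => ?_
    have : u • p + v • q = (u * α + v * γ) • e 2 + (u * β + v * δ) • e 3 := by
      rw [hpe, hqe]; module
    rw [this, eval_smul_add_smul hf, hℓ]
    simp
  obtain ⟨D, hD, hD'⟩ := HasFDerivAt.lineCubic f (reVec.hasFDerivAt.comp (0 : ℂ × ℂ) hW)
    (imVec.hasFDerivAt.comp (0 : ℂ × ℂ) hW).neg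
  have hσ := complexCubicCoeff.symm.toLinearMap.toContinuousLinearMap.hasFDerivAt.comp
    (0 : ℂ × ℂ) hD
  refine ⟨_, hσ, Complex.normSq (LinearMap.det (transversalDeriv e W)) / 16 *
    (α * δ - β * γ) ^ 4, ?_, ?_⟩
  · have h1 := Complex.normSq_pos.2 (det_transversalDeriv_ne_zero hw)
    have h2 : 0 < (α * δ - β * γ) ^ 4 := by positivity
    positivity
  -- The basis `p`, `q` of the plane, adapted to the chart, replaces `e 2`, `e 3` at the cost of a
  -- fourth power.
  · rw [mul_assoc, ← det_lineJacobian_change, ← hpe, ← hqe, ← det_symm_comp_toLin'_comp,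
      ContinuousLinearMap.det]
    congr 1
    refine LinearMap.ext fun η => ?_
    change complexCubicCoeff.symm (D η) = complexCubicCoeff.symm
      ((lineJacobian f (e 0) (e 1) p q).mulVec (realPairCoord (transversalDeriv e W η)))
    congr 1
    rw [hD']
    set x := realPairCoord (transversalDeriv e W η) with hx
    -- Each velocity splits into a transversal part along `e 0`, `e 1`, recorded by `x`, and a part
    -- inside the plane, which does not matter.
    have hexp (v : Fin 4 → ℝ) : v = e.coord 0 v • e 0 + e.coord 1 v • e 1 +
        ((e.coord 2 v * a + e.coord 3 v * c) • p + (e.coord 2 v * b + e.coord 3 v * d) • q) := by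
      conv_lhs => rw [← e.sum_repr v]
      simp only [Fin.sum_univ_four, Module.Basis.coord_apply]
      conv_lhs => rw [h2, h3]
      module
    have hx0 : x 0 = e.coord 0 (reVec (W η)) := rfl
    have hx1 : x 1 = e.coord 0 (-imVec (W η)) := by rw [map_neg]; rfl
    have hx2 : x 2 = e.coord 1 (reVec (W η)) := rfl
    have hx3 : x 3 = e.coord 1 (-imVec (W η)) := by rw [map_neg]; rfl
    rw [← lineCubicDeriv_eq_mulVec hpq0 x
      (e.coord 2 (reVec (W η)) * a + e.coord 3 (reVec (W η)) * c)
      (e.coord 2 (reVec (W η)) * b + e.coord 3 (reVec (W η)) * d)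
      (e.coord 2 (-imVec (W η)) * a + e.coord 3 (-imVec (W η)) * c)
      (e.coord 2 (-imVec (W η)) * b + e.coord 3 (-imVec (W η)) * d), hx0, hx1, hx2, hx3,
      ← hexp, ← hexp]
    rfl

/-- The index is the sign of the Jacobian. -/
lemma HasIndex.eq_sign {ℓ : Submodule ℝ (Fin 4 → ℝ)} {d : ℤ} (h : HasIndex f ℓ d)
    (hf : f.IsHomogeneous 3) (hℓ : lineCubic f (e 2) (e 3) = 0)
    (hspan : ℓ = Submodule.span ℝ {e 2, e 3})
    (hdet : (lineJacobian f (e 0) (e 1) (e 2) (e 3)).det ≠ 0) :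
    d = ((SignType.sign (lineJacobian f (e 0) (e 1) (e 2) (e 3)).det : SignType) : ℤ) := by
  subst hspan
  obtain ⟨w, g, hw, hg, hd⟩ := h
  obtain ⟨D, hD, r, hr, hDdet⟩ := exists_hasFDerivAt_section hf hℓ hw
  have hgD : HasFDerivAt g D 0 := hD.congr_of_eventuallyEq (by
    filter_upwards [hg] with ζ hζ
    exact (lineCubic_eq_complexCubicCoeff hf).1 hζ)
  rw [hd.eq_sign (by rw [hgD.fderiv, hDdet]; exact mul_ne_zero hr.ne' hdet), hgD.fderiv, hDdet,
    sign_mul, sign_pos hr, one_mul]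

/-- A single smooth chart suffices for existence, since by `HasIndex.eq_sign` all charts give the
same value. -/
lemma hasIndex_of_chart (hf : f.IsHomogeneous 3) (hℓ : lineCubic f (e 2) (e 3) = 0)
    (hw : IsPolarChart (Submodule.span ℝ {e 2, e 3}) w) (hsmooth : ContDiff ℝ 1 w)
    (hdet : (lineJacobian f (e 0) (e 1) (e 2) (e 3)).det ≠ 0) :
    ∃ d : ℤ, HasIndex f (Submodule.span ℝ {e 2, e 3}) d := by
  obtain ⟨D, hD, r, hr, hDdet⟩ := exists_hasFDerivAt_section hf hℓ hw
  refine ⟨_, w, _, hw, Filter.Eventually.of_forall fun ζ =>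
    (lineCubic_eq_complexCubicCoeff hf).2 rfl, hasLocalDegree_of_det_ne_zero ?_ ?_ ?_⟩
  · exact complexCubicCoeff.symm.toLinearMap.toContinuousLinearMap.contDiff.comp
      (ContDiff.lineCubic f (reVec.contDiff.comp hsmooth) (imVec.contDiff.comp hsmooth).neg)
  · have hspan : Submodule.span ℝ {reVec (w 0), -imVec (w 0)} = Submodule.span ℝ {e 2, e 3} := by
      rw [← hw.center, polarPlane_eq]
    obtain ⟨⟨α, β, γ, δ, hpe, hqe, -⟩, -⟩ := exists_change_of_span_eq hspan
    rw [LinearEquiv.map_eq_zero_iff]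
    refine lineCubic_eq_zero hf fun u v => ?_
    have : u • reVec (w 0) + v • -imVec (w 0) =
        (u * α + v * γ) • e 2 + (u * β + v * δ) • e 3 := by
      rw [hpe, hqe]; module
    rw [this, eval_smul_add_smul hf, hℓ]
    simp
  · rw [hD.fderiv, hDdet]
    exact mul_ne_zero hr.ne' hdet

end Chart

/-! ### Orthonormal frames, Segre coordinates and a chart at every line -/

/-- Two orthonormal vectors are the last two of an orthonormal basis. -/
lemma exists_orthonormal_basis_extending {p q : Fin 4 → ℝ} (hp : p ⬝ᵥ p = 1) (hq : q ⬝ᵥ q = 1)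
    (hpq : p ⬝ᵥ q = 0) :
    ∃ e : Module.Basis (Fin 4) ℝ (Fin 4 → ℝ), e 2 = p ∧ e 3 = q ∧
      ∀ i j, e i ⬝ᵥ e j = if i = j then 1 else 0 := by
  -- The zeros are placeholders: only the entries 2 and 3 are prescribed in the extension.
  let v : Fin 4 → EuclideanSpace ℝ (Fin 4) := ![0, 0, WithLp.toLp 2 p, WithLp.toLp 2 q]
  have hqp : q ⬝ᵥ p = 0 := by rw [dotProduct_comm, hpq]
  have hv : Orthonormal ℝ (Set.domRestrict ({2, 3} : Set (Fin 4)) v) := by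
    rw [orthonormal_iff_ite]
    rintro ⟨i, rfl | rfl⟩ ⟨j, rfl | rfl⟩ <;> rw [EuclideanSpace.inner_eq_star_dotProduct] <;>
      simp [v, Set.domRestrict, Subtype.ext_iff, hp, hq, hpq, hqp]
  obtain ⟨b, hb⟩ := hv.exists_orthonormalBasis_extension_of_card_eq (by simp)
  refine ⟨b.toBasis.map (WithLp.linearEquiv 2 ℝ (Fin 4 → ℝ)), ?_, ?_, fun i j => ?_⟩
  · simp [hb 2 (by simp), v]
  · simp [hb 3 (by simp), v]
  · have h := orthonormal_iff_ite.1 b.orthonormal j i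
    rw [EuclideanSpace.inner_eq_star_dotProduct] at h
    simpa [eq_comm] using h

/-- A plane is spanned by two orthonormal vectors. -/
lemma exists_orthonormal_span_eq {ℓ : Submodule ℝ (Fin 4 → ℝ)} (h : Module.finrank ℝ ℓ = 2) :
    ∃ p q : Fin 4 → ℝ, p ⬝ᵥ p = 1 ∧ q ⬝ᵥ q = 1 ∧ p ⬝ᵥ q = 0 ∧ ℓ = Submodule.span ℝ {p, q} := by
  let E := WithLp.linearEquiv 2 ℝ (Fin 4 → ℝ)
  let ℓ' : Submodule ℝ (EuclideanSpace ℝ (Fin 4)) := ℓ.map E.symm.toLinearMap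
  have hℓ' : Module.finrank ℝ ℓ' = 2 := by rw [← h]; exact LinearEquiv.finrank_map_eq E.symm ℓ
  let b := (stdOrthonormalBasis ℝ ℓ').reindex (finCongr hℓ')
  have hmem (i : Fin 2) : E (b i : EuclideanSpace ℝ (Fin 4)) ∈ ℓ := by
    obtain ⟨v, hv, hvb⟩ := (b i).2
    rw [← hvb]
    simpa using hv
  have hdot (i j : Fin 2) : E (b i : EuclideanSpace ℝ (Fin 4)) ⬝ᵥ
      E (b j : EuclideanSpace ℝ (Fin 4)) = if i = j then 1 else 0 := by
    have h := orthonormal_iff_ite.1 b.orthonormal j i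
    rw [Submodule.coe_inner, EuclideanSpace.inner_eq_star_dotProduct] at h
    simpa [eq_comm, E] using h
  refine ⟨E (b 0 : EuclideanSpace ℝ (Fin 4)), E (b 1 : EuclideanSpace ℝ (Fin 4)),
    by simp [hdot], by simp [hdot], by simp [hdot], le_antisymm (fun x hx => ?_) ?_⟩
  · have hx' : E.symm x ∈ ℓ' := ⟨x, hx, rfl⟩
    have hsum := congrArg (fun y : ℓ' => E (y : EuclideanSpace ℝ (Fin 4))) (b.sum_repr ⟨_, hx'⟩)
    rw [Submodule.mem_span_pair]
    refine ⟨b.repr ⟨_, hx'⟩ 0, b.repr ⟨_, hx'⟩ 1, ?_⟩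
    simpa [Fin.sum_univ_two] using hsum
  · rw [Submodule.span_le]
    rintro x (rfl | rfl)
    · exact hmem 0
    · exact hmem 1

/-- The real lines have Segre coordinates. -/
lemma exists_segreCoordinates {f : MvPolynomial (Fin 4) ℝ} (hf : f.IsHomogeneous 3)
    {ℓ : Submodule ℝ (Fin 4 → ℝ)} (hℓ : ℓ ∈ realLines f)
    (e : Module.Basis (Fin 4) ℝ (Fin 4 → ℝ)) (he : ℓ = Submodule.span ℝ {e 2, e 3}) :
    ∃ S : SegreCoordinates f ℓ, S.e = e := by
  let lin (p q : Fin 4 → ℝ) : (Fin 2 → ℝ) →ₗ[ℝ] ℝ :=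
    { toFun := fun a => 3 * cubicPolar f p q (a 0 • e 0 + a 1 • e 1)
      map_add' := fun a b => by
        simp only [cubicPolar.add₃, cubicPolar.smul₃, Pi.add_apply]
        ring
      map_smul' := fun r a => by
        simp only [cubicPolar.add₃, cubicPolar.smul₃, Pi.smul_apply, smul_eq_mul, RingHom.id_apply]
        ring }
  let X (i : Fin 2) : (Fin 2 → ℝ) →ₗ[ℝ] ℝ := LinearMap.proj i
  let quad (p : Fin 4 → ℝ) : QuadraticForm ℝ (Fin 2 → ℝ) :=
    (3 * cubicPolar f (e 0) (e 0) p) • QuadraticMap.linMulLin (X 0) (X 0) +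
      (6 * cubicPolar f (e 0) (e 1) p) • QuadraticMap.linMulLin (X 0) (X 1) +
      (3 * cubicPolar f (e 1) (e 1) p) • QuadraticMap.linMulLin (X 1) (X 1)
  have hquad (p : Fin 4 → ℝ) (x y : ℝ) : quad p ![x, y] =
      3 * cubicPolar f (x • e 0 + y • e 1) (x • e 0 + y • e 1) p := by
    simp only [cubicPolar.add₁, cubicPolar.smul₁, cubicPolar.add₂, cubicPolar.smul₂,
      cubicPolar.swap₁₂ f (e 1) (e 0)]
    simp [quad, X]
    ring
  refine ⟨{
    e := e
    line_eq := he
    L₁₁ := lin (e 2) (e 2)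
    L₁₂ := lin (e 2) (e 3)
    L₂₂ := lin (e 3) (e 3)
    Q₁ := quad (e 2)
    Q₂ := quad (e 3)
    C := MvPolynomial.aeval (fun i => MvPolynomial.C (e 0 i) * MvPolynomial.X 0 +
      MvPolynomial.C (e 1 i) * MvPolynomial.X 1) f
    C_homogeneous := by
      exact hf.aeval (n := 1) _ fun i =>
        (MvPolynomial.isHomogeneous_C_mul_X _ _).add (MvPolynomial.isHomogeneous_C_mul_X _ _)
    shape := fun x y u v => ?_ }, rfl⟩
  have hC : MvPolynomial.eval ![x, y] (MvPolynomial.aeval (fun i => MvPolynomial.C (e 0 i) *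
      MvPolynomial.X 0 + MvPolynomial.C (e 1 i) * MvPolynomial.X 1) f) =
        MvPolynomial.eval (x • e 0 + y • e 1) f := by
    rw [← MvPolynomial.aeval_eq_eval, ← MvPolynomial.aeval_eq_eval, MvPolynomial.comp_aeval_apply]
    congr 2
    ext i
    simp [mul_comm]
  rw [eval_add_smul_add_smul hf, hC, hquad, hquad,
    hℓ.2 _ (he.ge (Submodule.mem_span_pair.2 ⟨u, v, rfl⟩)), cubicPolar.eval_eq hf]
  simp [lin]
  ring

lemma complexVec_dotProduct (a b : Fin 4 → ℝ) :
    complexVec a ⬝ᵥ complexVec b = ((a ⬝ᵥ b : ℝ) : ℂ) := by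
  simp [dotProduct, complexVec]

/-- The rational parametrization of the quadric at the point corresponding to the plane of the last
two vectors of an orthonormal basis. -/
noncomputable def quadricChart (e : Fin 4 → Fin 4 → ℝ) (ζ : ℂ × ℂ) : Fin 4 → ℂ :=
  complexVec (e 2) - Complex.I • complexVec (e 3) + ζ.1 • complexVec (e 0) +
    ζ.2 • complexVec (e 1) -
    ((ζ.1 ^ 2 + ζ.2 ^ 2) / 4) • (complexVec (e 2) + Complex.I • complexVec (e 3))

lemma contDiff_quadricChart (e : Fin 4 → Fin 4 → ℝ) (n : WithTop ℕ∞) :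
    ContDiff ℂ n (quadricChart e) := by
  unfold quadricChart
  fun_prop

lemma fderiv_quadricChart (e : Fin 4 → Fin 4 → ℝ) (η : ℂ × ℂ) :
    fderiv ℂ (quadricChart e) 0 η = η.1 • complexVec (e 0) + η.2 • complexVec (e 1) := by
  have h1 := (ContinuousLinearMap.fst ℂ ℂ ℂ).hasFDerivAt (x := 0)
  have h2 := (ContinuousLinearMap.snd ℂ ℂ ℂ).hasFDerivAt (x := 0)
  have h : HasFDerivAt (quadricChart e) _ 0 :=
    (((h1.smul_const (complexVec (e 0))).const_add
      (complexVec (e 2) - Complex.I • complexVec (e 3))).add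
      (h2.smul_const (complexVec (e 1)))).sub
      ((((h1.pow 2).add (h2.pow 2)).mul_const (4⁻¹ : ℂ)).smul_const
        (complexVec (e 2) + Complex.I • complexVec (e 3)))
  rw [h.fderiv]
  simp

/-- The vectors `e 2 ∓ i e 3` are isotropic with product 2 and orthogonal to `e 0`, `e 1`. A
coefficient `t` of the second therefore adds `4t` to `ζ₁² + ζ₂²`, whence `t = -(ζ₁² + ζ₂²)/4`. -/
lemma isPolarChart_quadricChart {e : Module.Basis (Fin 4) ℝ (Fin 4 → ℝ)}
    (he : ∀ i j, e i ⬝ᵥ e j = if i = j then 1 else 0) :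
    IsPolarChart (Submodule.span ℝ {e 2, e 3}) (quadricChart e) where
  holomorphic := (contDiff_quadricChart e _).contDiffAt.analyticAt
  mem_quadric := Filter.Eventually.of_forall fun ζ => by
    have h : ∑ i, quadricChart e ζ i ^ 2 = quadricChart e ζ ⬝ᵥ quadricChart e ζ := by
      simp [dotProduct, sq]
    rw [h]
    simp only [quadricChart, dotProduct_add, add_dotProduct, dotProduct_sub, sub_dotProduct,
      dotProduct_smul, smul_dotProduct, complexVec_dotProduct, he, smul_eq_mul]
    simp
    linear_combination (1 + ((ζ.1 ^ 2 + ζ.2 ^ 2) / 4) ^ 2 + (ζ.1 ^ 2 + ζ.2 ^ 2) / 2) * Complex.I_sq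
  regular := by
    rw [fderiv_quadricChart, fderiv_quadricChart, Fintype.linearIndependent_iff]
    intro c hc
    have key (j : Fin 4) := congrArg (fun v => complexVec (e j) ⬝ᵥ v) hc
    simp only [Fin.sum_univ_three, Matrix.cons_val, quadricChart, dotProduct_add,
      dotProduct_sub, dotProduct_smul, complexVec_dotProduct, he, smul_eq_mul,
      dotProduct_zero] at key
    have k0 := key 0
    have k1 := key 1
    have k2 := key 2
    simp at k0 k1 k2
    intro i
    fin_cases i
    · exact k2
    · exact k0
    · exact k1
  center := by
    rw [polarPlane_eq]
    congr 2
    · ext i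
      simp [quadricChart, complexVec]
    · congr 1
      ext i
      simp [quadricChart, complexVec]

/-! ### Isolation and finiteness of the real lines -/

/-- A line of the surface with nonvanishing Jacobian is isolated. -/
lemma SegreCoordinates.eventually_span_eq {f : MvPolynomial (Fin 4) ℝ} (hf : f.IsHomogeneous 3)
    {ℓ : Submodule ℝ (Fin 4 → ℝ)} (hℓ : ℓ ∈ realLines f) (S : SegreCoordinates f ℓ)
    (hdet : S.jacobian.det ≠ 0) :
    ∀ᶠ x : (Fin 4 → ℝ) × (Fin 4 → ℝ) in nhds (S.e 2, S.e 3), lineCubic f x.1 x.2 = 0 →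
      Submodule.span ℝ {x.1, x.2} = ℓ := by
  obtain ⟨c, hc, hD⟩ := S.exists_isSectionInCoordinates hf hℓ
  have hDdet : (Matrix.toLin' S.jacobian).toContinuousLinearMap.det ≠ 0 := by
    rw [ContinuousLinearMap.det, LinearMap.coe_toContinuousLinearMap, LinearMap.det_toLin']
    exact hdet
  have hne : ∀ᶠ a in nhds (0 : Fin 4 → ℝ), c a = 0 → a = 0 := by
    have h := hD.eventually_ne (c := 0)
      ⟨_, (ContinuousLinearMap.toContinuousLinearEquivOfDetNeZero _ hDdet).antilipschitz⟩
    rw [eventually_nhdsWithin_iff] at h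
    filter_upwards [h] with a ha h0
    by_contra hne
    exact ha hne h0
  let k (i : Fin 4) (v : Fin 4 → ℝ) : ℝ := S.e.coord i v
  have hk (i : Fin 4) : Continuous (k i) := LinearMap.continuous_of_finiteDimensional _
  have hkfst (i : Fin 4) : Continuous fun x : (Fin 4 → ℝ) × (Fin 4 → ℝ) => k i x.1 :=
    (hk i).comp continuous_fst
  have hksnd (i : Fin 4) : Continuous fun x : (Fin 4 → ℝ) × (Fin 4 → ℝ) => k i x.2 :=
    (hk i).comp continuous_snd
  -- `Δ` is the minor that is nonzero when the plane of `x` lies in the affine chart centred at `ℓ`;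
  -- `A` gives its coordinates there by Cramer's rule.
  let Δ (x : (Fin 4 → ℝ) × (Fin 4 → ℝ)) : ℝ := k 2 x.1 * k 3 x.2 - k 3 x.1 * k 2 x.2
  have hΔ : Continuous Δ := ((hkfst 2).mul (hksnd 3)).sub ((hkfst 3).mul (hksnd 2))
  have hΔ0 : Δ (S.e 2, S.e 3) = 1 := by simp [Δ, k]
  let A (x : (Fin 4 → ℝ) × (Fin 4 → ℝ)) : Fin 4 → ℝ :=
    (Δ x)⁻¹ • ![k 3 x.2 * k 0 x.1 - k 3 x.1 * k 0 x.2, k 2 x.1 * k 0 x.2 - k 2 x.2 * k 0 x.1,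
      k 3 x.2 * k 1 x.1 - k 3 x.1 * k 1 x.2, k 2 x.1 * k 1 x.2 - k 2 x.2 * k 1 x.1]
  have hA : ContinuousAt A (S.e 2, S.e 3) := by
    refine (hΔ.continuousAt.inv₀ (by rw [hΔ0]; exact one_ne_zero)).smul
      (Continuous.continuousAt (continuous_pi fun i => ?_))
    fin_cases i
    · exact ((hksnd 3).mul (hkfst 0)).sub ((hkfst 3).mul (hksnd 0))
    · exact ((hkfst 2).mul (hksnd 0)).sub ((hksnd 2).mul (hkfst 0))
    · exact ((hksnd 3).mul (hkfst 1)).sub ((hkfst 3).mul (hksnd 1))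
    · exact ((hkfst 2).mul (hksnd 1)).sub ((hksnd 2).mul (hkfst 1))
  have hA0 : A (S.e 2, S.e 3) = 0 := by
    ext i
    fin_cases i <;> simp [A, k]
  have hev := hA.eventually (hA0.symm ▸ hne : ∀ᶠ a in nhds (A (S.e 2, S.e 3)), c a = 0 → a = 0)
  filter_upwards [hev, hΔ.continuousAt.eventually_ne (hΔ0.symm ▸ one_ne_zero)] with x hx hΔx h0
  have hexp (v : Fin 4 → ℝ) :
      v = k 0 v • S.e 0 + k 1 v • S.e 1 + k 2 v • S.e 2 + k 3 v • S.e 3 := by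
    conv_lhs => rw [← S.e.sum_repr v]
    simp only [Fin.sum_univ_four]
    rfl
  have hp : A x 0 • S.e 0 + A x 2 • S.e 1 + S.e 2 =
      ((Δ x)⁻¹ * k 3 x.2) • x.1 + (-((Δ x)⁻¹ * k 3 x.1)) • x.2 := by
    conv_rhs => enter [1, 2]; rw [hexp x.1]
    conv_rhs => enter [2, 2]; rw [hexp x.2]
    have : S.e 2 = ((Δ x)⁻¹ * Δ x) • S.e 2 := by rw [inv_mul_cancel₀ hΔx, one_smul]
    conv_lhs => enter [2]; rw [this]
    simp [A, Δ]
    module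
  have hq : A x 1 • S.e 0 + A x 3 • S.e 1 + S.e 3 =
      (-((Δ x)⁻¹ * k 2 x.2)) • x.1 + ((Δ x)⁻¹ * k 2 x.1) • x.2 := by
    conv_rhs => enter [1, 2]; rw [hexp x.1]
    conv_rhs => enter [2, 2]; rw [hexp x.2]
    have : S.e 3 = ((Δ x)⁻¹ * Δ x) • S.e 3 := by rw [inv_mul_cancel₀ hΔx, one_smul]
    conv_lhs => enter [2]; rw [this]
    simp [A, Δ]
    module
  -- The normalized spanning vectors lie in the plane of `x`, where `f` vanishes, so `A x` is a zero
  -- of the section near `0`.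
  have hAx : A x = 0 := by
    refine hx (binaryCubic_coeff_ext fun u v => ?_)
    rw [← hc, hp, hq]
    have (a b a' b' : ℝ) : u • (a • x.1 + b • x.2) + v • (a' • x.1 + b' • x.2) =
        (u * a + v * a') • x.1 + (u * b + v * b') • x.2 := by module
    rw [this, eval_smul_add_smul hf, h0]
    simp
  simp only [hAx, Pi.zero_apply, zero_smul, zero_add] at hp hq
  rw [S.line_eq]
  have h1 : x.1 = k 2 x.1 • S.e 2 + k 3 x.1 • S.e 3 := by
    rw [hp, hq]
    have : x.1 = ((Δ x)⁻¹ * Δ x) • x.1 := by rw [inv_mul_cancel₀ hΔx, one_smul]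
    conv_lhs => rw [this]
    simp only [Δ]
    module
  have h2 : x.2 = k 2 x.2 • S.e 2 + k 3 x.2 • S.e 3 := by
    rw [hp, hq]
    have : x.2 = ((Δ x)⁻¹ * Δ x) • x.2 := by rw [inv_mul_cancel₀ hΔx, one_smul]
    conv_lhs => rw [this]
    simp only [Δ]
    module
  apply le_antisymm <;> rw [Submodule.span_le]
  · rintro v (rfl | rfl)
    · exact Submodule.mem_span_pair.2 ⟨_, _, h1.symm⟩
    · exact Submodule.mem_span_pair.2 ⟨_, _, h2.symm⟩
  · rintro v (rfl | rfl)
    · exact Submodule.mem_span_pair.2 ⟨_, _, hp.symm⟩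
    · exact Submodule.mem_span_pair.2 ⟨_, _, hq.symm⟩

/-- The orthonormal frames of the real lines on the surface. -/
def lineFrames (f : MvPolynomial (Fin 4) ℝ) : Set ((Fin 4 → ℝ) × (Fin 4 → ℝ)) :=
  {x | x.1 ⬝ᵥ x.1 = 1 ∧ x.2 ⬝ᵥ x.2 = 1 ∧ x.1 ⬝ᵥ x.2 = 0 ∧ lineCubic f x.1 x.2 = 0}

lemma isCompact_lineFrames (f : MvPolynomial (Fin 4) ℝ) : IsCompact (lineFrames f) := by
  have hunit (v : Fin 4 → ℝ) (hv : v ⬝ᵥ v = 1) : ‖v‖ ≤ 1 := by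
    refine (pi_norm_le_iff_of_nonneg zero_le_one).2 fun i => ?_
    have h1 : v i * v i ≤ v ⬝ᵥ v :=
      Finset.single_le_sum (f := fun i => v i * v i) (fun j _ => mul_self_nonneg (v j))
        (Finset.mem_univ i)
    rw [Real.norm_eq_abs, abs_le_one_iff_mul_self_le_one]
    linarith
  refine Metric.isCompact_of_isClosed_isBounded ?_ ?_
  · have h1 : Continuous fun x : (Fin 4 → ℝ) × (Fin 4 → ℝ) => lineCubic f x.1 x.2 :=
      (ContDiff.lineCubic (n := 0) f contDiff_fst contDiff_snd).continuous
    have h2 : Continuous fun x : (Fin 4 → ℝ) × (Fin 4 → ℝ) => x.1 ⬝ᵥ x.1 := by fun_prop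
    have h3 : Continuous fun x : (Fin 4 → ℝ) × (Fin 4 → ℝ) => x.2 ⬝ᵥ x.2 := by fun_prop
    have h4 : Continuous fun x : (Fin 4 → ℝ) × (Fin 4 → ℝ) => x.1 ⬝ᵥ x.2 := by fun_prop
    exact (isClosed_eq h2 continuous_const).inter ((isClosed_eq h3 continuous_const).inter
      ((isClosed_eq h4 continuous_const).inter (isClosed_eq h1 continuous_const)))
  · refine (Metric.isBounded_closedBall (x := (0 : (Fin 4 → ℝ) × (Fin 4 → ℝ))) (r := 1)).subset
      fun x hx => ?_
    rw [mem_closedBall_zero_iff]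
    exact max_le (hunit _ hx.1) (hunit _ hx.2.1)

section Nonsingular

variable {f : MvPolynomial (Fin 4) ℝ} {ℓ : Submodule ℝ (Fin 4 → ℝ)}

lemma SegreCoordinates.det_jacobian_ne_zero (hf : f.IsHomogeneous 3)
    (hns : IsNonsingularSurface f) (hℓ : ℓ ∈ realLines f) (S : SegreCoordinates f ℓ) :
    S.jacobian.det ≠ 0 := by
  rw [S.jacobian_eq hf hℓ]
  exact det_lineJacobian_ne_zero hf hns S.e (S.lineCubic_eq_zero hf hℓ)

/-- A nonsingular cubic surface contains finitely many real lines. -/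
lemma finite_realLines (hf : f.IsHomogeneous 3) (hns : IsNonsingularSurface f) :
    (realLines f).Finite := by
  have : CompactSpace (lineFrames f) := isCompact_iff_compactSpace.1 (isCompact_lineFrames f)
  let F (x : lineFrames f) : Submodule ℝ (Fin 4 → ℝ) := Submodule.span ℝ {x.1.1, x.1.2}
  have hF : IsLocallyConstant F := by
    rw [IsLocallyConstant.iff_eventually_eq]
    rintro ⟨⟨p, q⟩, hp, hq, hpq, h0⟩
    obtain ⟨e, rfl, rfl, -⟩ := exists_orthonormal_basis_extending hp hq hpq
    have hmem : Submodule.span ℝ {e 2, e 3} ∈ realLines f := by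
      refine ⟨?_, fun v hv => ?_⟩
      · have hli : LinearIndependent ℝ ![e 2, e 3] := by
          convert! e.linearIndependent.comp ![2, 3] (by decide) using 1
          ext i : 1
          fin_cases i <;> rfl
        have hrange : Set.range ![e 2, e 3] = {e 2, e 3} := by
          ext v
          simp [or_comm]
        rw [← hrange, finrank_span_eq_card hli, Fintype.card_fin]
      · obtain ⟨u, v, rfl⟩ := Submodule.mem_span_pair.1 hv
        have h0' : lineCubic f (e 2) (e 3) = 0 := h0
        rw [eval_smul_add_smul hf, h0']
        simp
    obtain ⟨S, hS⟩ := exists_segreCoordinates hf hmem e rfl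
    have hev := S.eventually_span_eq hf hmem (S.det_jacobian_ne_zero hf hns hmem)
    rw [hS] at hev
    filter_upwards [continuous_subtype_val.continuousAt.eventually hev] with y hy
    exact hy y.2.2.2.2
  -- A locally constant map on a compact space has finite range, and every real line is the span of
  -- an orthonormal frame.
  refine hF.range_finite.subset fun ℓ hℓ => ?_
  obtain ⟨p, q, hp, hq, hpq, rfl⟩ := exists_orthonormal_span_eq hℓ.1
  exact ⟨⟨(p, q), hp, hq, hpq, lineCubic_eq_zero hf fun u v =>
    hℓ.2 _ (Submodule.mem_span_pair.2 ⟨u, v, rfl⟩)⟩, rfl⟩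

/-! ### Species and index -/

lemma exists_segreCoordinates_and_hasIndex (hf : f.IsHomogeneous 3)
    (hns : IsNonsingularSurface f) (hℓ : ℓ ∈ realLines f) :
    Nonempty (SegreCoordinates f ℓ) ∧ ∃ d : ℤ, HasIndex f ℓ d := by
  obtain ⟨p, q, hp, hq, hpq, rfl⟩ := exists_orthonormal_span_eq hℓ.1
  obtain ⟨e, rfl, rfl, he⟩ := exists_orthonormal_basis_extending hp hq hpq
  obtain ⟨S, hS⟩ := exists_segreCoordinates hf hℓ e rfl
  have h0 : lineCubic f (e 2) (e 3) = 0 := hS ▸ S.lineCubic_eq_zero hf hℓ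
  exact ⟨⟨S⟩, hasIndex_of_chart hf h0 (isPolarChart_quadricChart he)
    ((contDiff_quadricChart _ 1).restrict_scalars ℝ) (det_lineJacobian_ne_zero hf hns e h0)⟩

lemma HasIndex.eq_sign_det_jacobian (hf : f.IsHomogeneous 3) (hns : IsNonsingularSurface f)
    (hℓ : ℓ ∈ realLines f) {d : ℤ} (h : HasIndex f ℓ d) (S : SegreCoordinates f ℓ) :
    d = ((SignType.sign S.jacobian.det : SignType) : ℤ) := by
  have h0 := S.lineCubic_eq_zero hf hℓ
  rw [S.jacobian_eq hf hℓ]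
  exact h.eq_sign hf h0 S.line_eq (det_lineJacobian_ne_zero hf hns S.e h0)

/-- Both properties are read off from the sign of the same nonzero determinant, which is independent
of the Segre coordinates because the index is. -/
lemma isHyperbolicLine_iff (hf : f.IsHomogeneous 3) (hns : IsNonsingularSurface f)
    (hℓ : ℓ ∈ realLines f) : IsHyperbolicLine f ℓ ↔ HasIndex f ℓ 1 := by
  obtain ⟨⟨S⟩, d, hd⟩ := exists_segreCoordinates_and_hasIndex hf hns hℓ
  constructor
  · rintro ⟨S, hS⟩
    have h := (S.isIndefiniteForm_iff (S.det_jacobian_ne_zero hf hns hℓ)).1 hS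
    have := hd.eq_sign_det_jacobian hf hns hℓ S
    rw [sign_pos h] at this
    simpa [this] using hd
  · intro h
    have := h.eq_sign_det_jacobian hf hns hℓ S
    refine ⟨S, S.isIndefiniteForm_of_pos ?_⟩
    by_contra hn
    rw [sign_neg (lt_of_le_of_ne (not_lt.1 hn) (S.det_jacobian_ne_zero hf hns hℓ))] at this
    norm_num at this

lemma isEllipticLine_iff (hf : f.IsHomogeneous 3) (hns : IsNonsingularSurface f)
    (hℓ : ℓ ∈ realLines f) : IsEllipticLine f ℓ ↔ HasIndex f ℓ (-1) := by
  obtain ⟨⟨S⟩, d, hd⟩ := exists_segreCoordinates_and_hasIndex hf hns hℓ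
  constructor
  · rintro ⟨S, hS⟩
    have h := (S.isDefiniteForm_iff (S.det_jacobian_ne_zero hf hns hℓ)).1 hS
    have := hd.eq_sign_det_jacobian hf hns hℓ S
    rw [sign_neg h] at this
    simpa [this] using hd
  · intro h
    have := h.eq_sign_det_jacobian hf hns hℓ S
    refine ⟨S, S.isDefiniteForm_of_neg ?_⟩
    by_contra hn
    rw [sign_pos (lt_of_le_of_ne (not_lt.1 hn) (S.det_jacobian_ne_zero hf hns hℓ).symm)] at this
    norm_num at this

end Nonsingular

theorem mainTheorem4 (f : MvPolynomial (Fin 4) ℝ) (hf : f.IsHomogeneous 3)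
    (hns : IsNonsingularSurface f) :
    (realLines f).Finite ∧
    (∀ ℓ ∈ realLines f,
      Xor (IsHyperbolicLine f ℓ) (IsEllipticLine f ℓ) ∧
      (∃! d : ℤ, HasIndex f ℓ d) ∧
      (IsHyperbolicLine f ℓ ↔ HasIndex f ℓ 1) ∧
      (IsEllipticLine f ℓ ↔ HasIndex f ℓ (-1)) ∧
      ∀ S : SegreCoordinates f ℓ,
        (∃ c : (Fin 4 → ℝ) → (Fin 4 → ℝ), S.IsSectionInCoordinates c ∧
          HasFDerivAt c (Matrix.toLin' S.jacobian).toContinuousLinearMap 0) ∧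
        S.jacobian.det = -(4 * QuadraticForm.discr' S.form) ∧
        HasIndex f ℓ ((SignType.sign S.jacobian.det : SignType) : ℤ)) ∧
    hyperbolicCount f = indexCount f 1 ∧
    ellipticCount f = indexCount f (-1) := by
  refine ⟨finite_realLines hf hns, fun ℓ hℓ => ?_, ?_, ?_⟩
  · obtain ⟨⟨S⟩, d, hd⟩ := exists_segreCoordinates_and_hasIndex hf hns hℓ
    have huniq {d' : ℤ} (h : HasIndex f ℓ d') : d' = d :=
      (h.eq_sign_det_jacobian hf hns hℓ S).trans (hd.eq_sign_det_jacobian hf hns hℓ S).symm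
    have hhyp := isHyperbolicLine_iff hf hns hℓ
    have hell := isEllipticLine_iff hf hns hℓ
    refine ⟨?_, ⟨d, hd, fun d' h => huniq h⟩, hhyp, hell, fun S =>
      ⟨S.exists_isSectionInCoordinates hf hℓ, S.det_jacobian,
        hd.eq_sign_det_jacobian hf hns hℓ S ▸ hd⟩⟩
    have hnot (h : HasIndex f ℓ 1) (h' : HasIndex f ℓ (-1)) : False := by
      have := (huniq h).trans (huniq h').symm
      norm_num at this
    rcases (S.det_jacobian_ne_zero hf hns hℓ).lt_or_gt with h | h
    · have he : IsEllipticLine f ℓ := ⟨S, S.isDefiniteForm_of_neg h⟩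
      exact Or.inr ⟨he, fun hh => hnot (hhyp.1 hh) (hell.1 he)⟩
    · have hh : IsHyperbolicLine f ℓ := ⟨S, S.isIndefiniteForm_of_pos h⟩
      exact Or.inl ⟨hh, fun he => hnot (hhyp.1 hh) (hell.1 he)⟩
  · rw [hyperbolicCount, indexCount]
    congr 1
    ext ℓ
    exact and_congr_right fun hℓ => isHyperbolicLine_iff hf hns hℓ
  · rw [ellipticCount, indexCount]
    congr 1
    ext ℓ
    exact and_congr_right fun hℓ => isEllipticLine_iff hf hns hℓ
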